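/- Let $S$ be a commutative Clifford semigroup, i.e. a commutative semigroup which is isomorphic to a strong semilattice of groups: there are a semilattice $L$ (a commutative semigroup of idempotents, ordered by $f\preceq e \iff ef=f$), groups $(G_e)_{e\in L}$ and homomorphisms $\varphi_{f,e}:G_e\to G_f$ for $e\succeq f$ with $\varphi_{e,e}=\mathrm{id}$ and $\varphi_{g,f}\circ\varphi_{f,e}=\varphi_{g,e}$ whenever $e\succeq f\succeq g$, such that $S\cong\coprod_{e\in L}G_e$ with product $x\cdot y=\varphi_{ef,e}(x)\,\varphi_{ef,f}(y)$ for $x\in G_e$, $y\in G_f$. Let $A=\ell^1(S)$ be the complex Banach algebra of absolutely summable functions $S\to\mathbb{C}$ with the convolution product $(f*g)(s)=\sum_{xy=s}f(x)g(y)$, and let $X$ be any symmetric Banach $A$-bimodule, i.e. a complex Banach space with commuting bounded bilinear left and right actions of $A$ such that $a\cdot x=x\cdot a$ for all $a\in A$, $x\in X$. Let $C^n(A,X)$ be the space of bounded $n$-linear maps $A^n\to X$ (with $C^0(A,X)=X$), let $\delta^n:C^n(A,X)\to C^{n+1}(A,X)$ be the Hochschild coboundary operator $$(\delta^n\psi)(a_1,\dots,a_{n+1})=a_1\cdot\psi(a_2,\dots,a_{n+1})+\sum_{j=1}^{n}(-1)^j\psi(a_1,\dots,a_ja_{j+1},\dots,a_{n+1})+(-1)^{n+1}\psi(a_1,\dots,a_n)\cdot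 a_{n+1},$$ and for $n\geq 1$ let $\mathcal{H}^n(A,X)=\ker\delta^n/\operatorname{im}\delta^{n-1}$ be the continuous Hochschild cohomology groups. Then $$\mathcal{H}^n(\ell^1(S),X)=0\qquad\text{for all } n\geq 1 .$$ -/

import Mathlib

/-! ## Strong semilattices of semigroups and Clifford semigroups -/

universe u v

/-- A semilattice diagram of semigroups: a semilattice `L` (a commutative idempotent semigroup,
written `⊓`, whose canonical order is `f ≤ e ↔ e ⊓ f = f`), a semigroup `T e` for each `e : L`, and
compatible semigroup homomorphisms `T e → T f` for `f ≤ e`. -/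
structure SemilatticeDiagram (L : Type u) [SemilatticeInf L] (T : L → Type v)
    [∀ e, Semigroup (T e)] where
  /-- the transition homomorphism `T e → T f` for `f ≤ e` -/
  map : ∀ {e f : L}, f ≤ e → (T e →ₙ* T f)
  map_self : ∀ {e : L} (x : T e), map (le_refl e) x = x
  map_map : ∀ {e f g : L} (hfe : f ≤ e) (hgf : g ≤ f) (x : T e),
    map hgf (map hfe x) = map (hgf.trans hfe) x

namespace SemilatticeDiagram

variable {L : Type u} [SemilatticeInf L] {T : L → Type v} [∀ e, Semigroup (T e)]

/-- The underlying set of the strong semilattice of semigroups: the disjoint union of the `T e`. -/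
structure Total (D : SemilatticeDiagram L T) : Type (max u v) where
  base : L
  val : T base

theorem Total.ext_map (D : SemilatticeDiagram L T) {x y : D.Total} (h : y.base = x.base)
    (hv : D.map h.le x.val = y.val) : x = y := by
  obtain ⟨e, x⟩ := x
  obtain ⟨f, y⟩ := y
  dsimp only at h
  subst h
  dsimp only at hv
  rw [D.map_self] at hv
  rw [hv]

/-- The product of `x ∈ T e` and `y ∈ T f` is the product of their images in `T (e ⊓ f)`. -/
instance (D : SemilatticeDiagram L T) : Mul D.Total where
  mul x y := ⟨x.base ⊓ y.base, D.map inf_le_left x.val * D.map inf_le_right y.val⟩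

instance (D : SemilatticeDiagram L T) : Semigroup D.Total where
  mul_assoc x y z := by
    refine Total.ext_map D (inf_assoc _ _ _).symm ?_
    change D.map _ (D.map _ (D.map _ _ * D.map _ _) * D.map _ _) =
      D.map _ _ * D.map _ (D.map _ _ * D.map _ _)
    simp only [map_mul, D.map_map, mul_assoc]

end SemilatticeDiagram

/-- A Clifford semigroup is a strong semilattice of groups. (If `S` is isomorphic to the total
semigroup of a diagram in any universes then `L` and all `G e` embed into `S`, so that taking them
in the universe of `S` loses nothing.) -/
def IsCliffordSemigroup (S : Type u) [Semigroup S] : Prop :=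
  ∃ (L : Type u) (_ : SemilatticeInf L) (G : L → Type u) (_ : ∀ e, Group (G e))
    (D : SemilatticeDiagram L G), Nonempty (S ≃* D.Total)

/-! ## The convolution algebra of a semigroup -/

/-- The Banach space `ℓ¹(S)` of absolutely summable functions `S → ℂ`. -/
abbrev EllOne (S : Type u) : Type u := lp (fun _ : S => ℂ) 1

namespace EllOne

variable {S : Type u}

theorem summable_norm (f : EllOne S) : Summable fun s => ‖f s‖ := by
  simpa using (lp.hasSum_norm (p := 1) (by simp) f).summable

theorem norm_eq (f : EllOne S) : ‖f‖ = ∑' s, ‖f s‖ := by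
  simpa using lp.norm_eq_tsum_rpow (p := 1) (by simp) f

theorem summable_norm_mul (f g : EllOne S) :
    Summable fun p : S × S => ‖f p.1 * g p.2‖ := by
  simpa only [norm_mul] using
    f.summable_norm.mul_of_nonneg g.summable_norm (fun _ => norm_nonneg _) fun _ => norm_nonneg _

variable [Semigroup S]

/-- The coefficients of the convolution product: `(f * g)(s) = ∑_{x y = s} f(x) g(y)`. -/
noncomputable def convFun (f g : EllOne S) (s : S) : ℂ :=
  ∑' p : (fun p : S × S => p.1 * p.2) ⁻¹' {s}, f p.1.1 * g p.1.2

theorem summable_fiber (f g : EllOne S) (s : S) :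
    Summable fun p : (fun p : S × S => p.1 * p.2) ⁻¹' {s} => f p.1.1 * g p.1.2 :=
  (summable_norm_mul f g).of_norm.subtype _

theorem hasSum_fiber_norm (f g : EllOne S) :
    HasSum (fun s => ∑' p : (fun p : S × S => p.1 * p.2) ⁻¹' {s}, ‖f p.1.1 * g p.1.2‖)
      (‖f‖ * ‖g‖) := by
  have h := (summable_norm_mul f g).hasSum.tsum_fiberwise (fun p : S × S => p.1 * p.2)
  have e : ∑' p : S × S, ‖f p.1 * g p.2‖ = ‖f‖ * ‖g‖ := by
    rw [norm_eq, norm_eq, f.summable_norm.tsum_mul_tsum g.summable_norm]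
    · simp only [norm_mul]
    · simpa only [norm_mul] using summable_norm_mul f g
  rw [e] at h
  exact h

theorem norm_convFun_le (f g : EllOne S) (s : S) : ‖convFun f g s‖ ≤
    ∑' p : (fun p : S × S => p.1 * p.2) ⁻¹' {s}, ‖f p.1.1 * g p.1.2‖ :=
  norm_tsum_le_tsum_norm ((summable_norm_mul f g).subtype _)

theorem summable_norm_convFun (f g : EllOne S) : Summable fun s => ‖convFun f g s‖ :=
  (hasSum_fiber_norm f g).summable.of_nonneg_of_le (fun _ => norm_nonneg _) (norm_convFun_le f g)

/-- The convolution product on `ℓ¹(S)`. -/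
noncomputable def conv (f g : EllOne S) : EllOne S :=
  ⟨convFun f g, memℓp_gen (by simpa using summable_norm_convFun f g)⟩

theorem norm_conv_le (f g : EllOne S) : ‖conv f g‖ ≤ ‖f‖ * ‖g‖ := by
  rw [norm_eq, ← (hasSum_fiber_norm f g).tsum_eq]
  exact (summable_norm_convFun f g).tsum_le_tsum (norm_convFun_le f g)
    (hasSum_fiber_norm f g).summable

theorem conv_apply (f g : EllOne S) (s : S) : conv f g s =
    ∑' p : (fun p : S × S => p.1 * p.2) ⁻¹' {s}, f p.1.1 * g p.1.2 := rfl

/-- Convolution as a bounded bilinear map. -/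
noncomputable def convL : EllOne S →L[ℂ] EllOne S →L[ℂ] EllOne S :=
  LinearMap.mkContinuous₂
    (LinearMap.mk₂ ℂ conv
      (fun f f' g => lp.ext <| funext fun s => by
        simp only [conv_apply, lp.coeFn_add, Pi.add_apply, add_mul]
        exact (summable_fiber f g s).tsum_add (summable_fiber f' g s))
      (fun c f g => lp.ext <| funext fun s => by
        simp only [conv_apply, lp.coeFn_smul, Pi.smul_apply, smul_mul_assoc]
        exact (summable_fiber f g s).tsum_const_smul c)
      (fun f g g' => lp.ext <| funext fun s => by
        simp only [conv_apply, lp.coeFn_add, Pi.add_apply, mul_add]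
        exact (summable_fiber f g s).tsum_add (summable_fiber f g' s))
      (fun c f g => lp.ext <| funext fun s => by
        simp only [conv_apply, lp.coeFn_smul, Pi.smul_apply, mul_smul_comm]
        exact (summable_fiber f g s).tsum_const_smul c))
    1 (fun f g => by simpa using norm_conv_le f g)

@[simp]
theorem convL_apply (f g : EllOne S) : convL f g = conv f g := rfl

open Classical in
theorem conv_single (x y : S) (a b : ℂ) :
    conv (lp.single 1 x a : EllOne S) (lp.single 1 y b) = lp.single 1 (x * y) (a * b) := by
  refine lp.ext <| funext fun s => ?_
  rw [conv_apply, tsum_subtype (f := fun p : S × S =>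
    (lp.single 1 x a : EllOne S) p.1 * (lp.single 1 y b : EllOne S) p.2),
    tsum_eq_single (x, y)]
  · by_cases h : x * y = s
    · subst h; simp
    · simp [Set.indicator, h, Ne.symm h]
  · rintro ⟨u, w⟩ h
    have : u ≠ x ∨ w ≠ y := by
      by_contra! h'
      exact h (Prod.ext h'.1 h'.2)
    rcases this with h | h <;> simp [Set.indicator, Pi.single_apply, h]

open Classical in
theorem conv_assoc (f g h : EllOne S) : conv (conv f g) h = conv f (conv g h) := by
  have e : (1 : ENNReal) ≠ ⊤ := by simp
  have key : ∀ (x y z : S) (a b c : ℂ),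
      conv (conv (lp.single 1 x a : EllOne S) (lp.single 1 y b)) (lp.single 1 z c) =
        conv (lp.single 1 x a) (conv (lp.single 1 y b) (lp.single 1 z c)) := by
    intro x y z a b c
    simp only [conv_single, mul_assoc]
  have key₂ : ∀ (x y : S) (a b : ℂ) (h : EllOne S),
      conv (conv (lp.single 1 x a : EllOne S) (lp.single 1 y b)) h =
        conv (lp.single 1 x a) (conv (lp.single 1 y b) h) := by
    intro x y a b h
    have : convL (convL (lp.single 1 x a : EllOne S) (lp.single 1 y b)) =
        (convL (lp.single 1 x a)).comp (convL (lp.single 1 y b)) :=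
      lp.ext_continuousLinearMap e fun z => ContinuousLinearMap.ext fun c => key x y z a b c
    exact DFunLike.congr_fun this h
  have key₁ : ∀ (x : S) (a : ℂ) (g h : EllOne S),
      conv (conv (lp.single 1 x a : EllOne S) g) h = conv (lp.single 1 x a) (conv g h) := by
    intro x a g h
    have : (convL.flip h).comp (convL (lp.single 1 x a : EllOne S)) =
        (convL (lp.single 1 x a)).comp (convL.flip h) :=
      lp.ext_continuousLinearMap e fun y => ContinuousLinearMap.ext fun b => key₂ x y a b h
    exact DFunLike.congr_fun this g
  have : (convL.flip h).comp (convL.flip g) = convL.flip (convL g h) :=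
    lp.ext_continuousLinearMap e fun x => ContinuousLinearMap.ext fun a => key₁ x a g h
  exact DFunLike.congr_fun this f

/-- `ℓ¹(S)` as a (not necessarily unital) Banach algebra under convolution. -/
noncomputable instance : NonUnitalNormedRing (EllOne S) :=
  { (inferInstance : NormedAddCommGroup (EllOne S)) with
    mul := conv
    left_distrib := fun f g h => (convL f).map_add g h
    right_distrib := fun f g h => DFunLike.congr_fun (convL.map_add f g) h
    zero_mul := fun f => DFunLike.congr_fun convL.map_zero f
    mul_zero := fun f => (convL f).map_zero
    mul_assoc := conv_assoc
    norm_mul_le := norm_conv_le }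

theorem mul_apply (f g : EllOne S) (s : S) : (f * g) s =
    ∑' p : (fun p : S × S => p.1 * p.2) ⁻¹' {s}, f p.1.1 * g p.1.2 := rfl

instance : IsScalarTower ℂ (EllOne S) (EllOne S) where
  smul_assoc c f g := DFunLike.congr_fun (convL.map_smul c f) g

instance : SMulCommClass ℂ (EllOne S) (EllOne S) where
  smul_comm c f g := ((convL f).map_smul c g).symm

end EllOne

/-! ## Continuous Hochschild cohomology -/

/-- A Banach `A`-bimodule structure on the Banach space `X`, for a Banach algebra `A` that need
not be unital: commuting bounded bilinear left and right actions, `left a x = a · x` and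
`right a x = x · a`. -/
structure BanachBimodule (A : Type u) (X : Type v) [NonUnitalNormedRing A] [NormedSpace ℂ A]
    [NormedAddCommGroup X] [NormedSpace ℂ X] where
  left : A →L[ℂ] X →L[ℂ] X
  right : A →L[ℂ] X →L[ℂ] X
  left_mul : ∀ (a b : A) (x : X), left (a * b) x = left a (left b x)
  right_mul : ∀ (a b : A) (x : X), right (a * b) x = right b (right a x)
  left_right : ∀ (a b : A) (x : X), left a (right b x) = right b (left a x)

namespace BanachBimodule

variable {A : Type u} {X : Type v} [NonUnitalNormedRing A] [NormedSpace ℂ A]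
  [NormedAddCommGroup X] [NormedSpace ℂ X]

/-- A bimodule is symmetric if `a · x = x · a` for all `a` and `x`. -/
def IsSymmetric (M : BanachBimodule A X) : Prop :=
  ∀ (a : A) (x : X), M.left a x = M.right a x

variable (A X) in
/-- The space `Cⁿ(A, X)` of `n`-cochains: bounded `n`-linear maps `A × ⋯ × A → X`
(so that `C⁰(A, X) = X`). -/
abbrev Cochain (n : ℕ) : Type (max u v) := ContinuousMultilinearMap ℂ (fun _ : Fin n => A) X

variable {n : ℕ}

/-- The coface `ψ ↦ ((a₀, …, aₙ) ↦ a₀ · ψ(a₁, …, aₙ))`. -/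
noncomputable def cofaceLeft (M : BanachBimodule A X) (ψ : Cochain A X n) :
    Cochain A X (n + 1) where
  toMultilinearMap := MultilinearMap.mk' (fun a => M.left (a 0) (ψ (Fin.tail a)))
    (fun a i x y => by
      induction i using Fin.cases with
      | zero => simp
      | succ i => simp [Fin.tail_update_succ, (Fin.succ_ne_zero i).symm])
    (fun a i c x => by
      induction i using Fin.cases with
      | zero => simp
      | succ i => simp [Fin.tail_update_succ, (Fin.succ_ne_zero i).symm])
  cont := by
    have h : Continuous fun a : Fin (n + 1) → A => (Fin.tail a : Fin n → A) :=
      continuous_pi fun k => continuous_apply k.succ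
    exact M.left.continuous₂.comp ((continuous_apply 0).prodMk (ψ.cont.comp h))

/-- The coface `ψ ↦ ((a₀, …, aₙ) ↦ ψ(a₀, …, aₙ₋₁) · aₙ)`. -/
noncomputable def cofaceRight (M : BanachBimodule A X) (ψ : Cochain A X n) :
    Cochain A X (n + 1) where
  toMultilinearMap := MultilinearMap.mk' (fun a => M.right (a (Fin.last n)) (ψ (Fin.init a)))
    (fun a i x y => by
      induction i using Fin.lastCases with
      | last => simp
      | cast i => simp [(Fin.castSucc_ne_last i).symm])
    (fun a i c x => by
      induction i using Fin.lastCases with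
      | last => simp
      | cast i => simp [(Fin.castSucc_ne_last i).symm])
  cont := by
    have h : Continuous fun a : Fin (n + 1) → A => (Fin.init a : Fin n → A) :=
      continuous_pi fun k => continuous_apply k.castSucc
    exact M.right.continuous₂.comp ((continuous_apply _).prodMk (ψ.cont.comp h))

variable [IsScalarTower ℂ A A] [SMulCommClass ℂ A A]

theorem contractNth_update (j : Fin n) (a : Fin (n + 1) → A) (i : Fin (n + 1)) :
    ∃ (k : Fin n) (T : A →ₗ[ℂ] A), ∀ x : A,
      Fin.contractNth j.castSucc (· * ·) (Function.update a i x) =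
        Function.update (Fin.contractNth j.castSucc (· * ·) a) k (T x) := by
  rcases lt_trichotomy (i : ℕ) j with h | h | h
  · refine ⟨⟨i, by omega⟩, LinearMap.id, fun x => ?_⟩
    ext m
    simp only [Fin.contractNth, Function.update_apply, Fin.ext_iff, Fin.val_castSucc, Fin.val_succ,
      LinearMap.id_apply]
    split_ifs <;> first | rfl | omega
  · refine ⟨j, LinearMap.mulRight ℂ (a j.succ), fun x => ?_⟩
    ext m
    simp only [Fin.contractNth, Function.update_apply, Fin.ext_iff, Fin.val_castSucc, Fin.val_succ,
      LinearMap.mulRight_apply]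
    split_ifs with h1 h2 h3 h4 h5 h6 h7 h8 h9 <;> first | rfl | omega | skip
    obtain rfl : m = j := Fin.ext (by omega)
    rfl
  · by_cases h' : (i : ℕ) = j + 1
    · refine ⟨j, LinearMap.mulLeft ℂ (a j.castSucc), fun x => ?_⟩
      ext m
      simp only [Fin.contractNth, Function.update_apply, Fin.ext_iff, Fin.val_castSucc,
        Fin.val_succ, LinearMap.mulLeft_apply]
      split_ifs <;> first | rfl | omega | skip
      obtain rfl : m = j := Fin.ext (by omega)
      rfl
    · refine ⟨⟨i - 1, by omega⟩, LinearMap.id, fun x => ?_⟩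
      ext m
      simp only [Fin.contractNth, Function.update_apply, Fin.ext_iff, Fin.val_castSucc,
        Fin.val_succ, LinearMap.id_apply]
      split_ifs <;> first | rfl | omega

/-- The coface `ψ ↦ ((a₀, …, aₙ) ↦ ψ(a₀, …, aⱼ aⱼ₊₁, …, aₙ))` for `0 ≤ j < n`. -/
noncomputable def cofaceMul (ψ : Cochain A X n) (j : Fin n) : Cochain A X (n + 1) where
  toMultilinearMap := MultilinearMap.mk' (fun a => ψ (Fin.contractNth j.castSucc (· * ·) a))
    (fun a i x y => by
      obtain ⟨k, T, h⟩ := contractNth_update j a i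
      simp [h])
    (fun a i c x => by
      obtain ⟨k, T, h⟩ := contractNth_update j a i
      simp [h])
  cont := by
    have h : Continuous fun a : Fin (n + 1) → A =>
        (Fin.contractNth j.castSucc (· * ·) a : Fin n → A) := by
      refine continuous_pi fun k => ?_
      unfold Fin.contractNth
      split_ifs <;> fun_prop
    exact ψ.cont.comp h

/-- The Hochschild coboundary operator `Cⁿ(A, X) → Cⁿ⁺¹(A, X)`. -/
noncomputable def coboundary (M : BanachBimodule A X) (n : ℕ) :
    Cochain A X n →ₗ[ℂ] Cochain A X (n + 1) where
  toFun ψ := M.cofaceLeft ψ + ∑ j : Fin n, (-1 : ℂ) ^ ((j : ℕ) + 1) • cofaceMul ψ j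
    + (-1 : ℂ) ^ (n + 1) • M.cofaceRight ψ
  map_add' ψ χ := by
    have h₁ : M.cofaceLeft (ψ + χ) = M.cofaceLeft ψ + M.cofaceLeft χ := by
      ext a; exact (M.left (a 0)).map_add _ _
    have h₂ : M.cofaceRight (ψ + χ) = M.cofaceRight ψ + M.cofaceRight χ := by
      ext a; exact (M.right (a (Fin.last n))).map_add _ _
    have h₃ : ∀ j, cofaceMul (ψ + χ) j = cofaceMul ψ j + cofaceMul χ j := fun j => rfl
    simp only [h₁, h₂, h₃, smul_add, Finset.sum_add_distrib]
    abel
  map_smul' c ψ := by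
    have h₁ : M.cofaceLeft (c • ψ) = c • M.cofaceLeft ψ := by
      ext a; exact (M.left (a 0)).map_smul _ _
    have h₂ : M.cofaceRight (c • ψ) = c • M.cofaceRight ψ := by
      ext a; exact (M.right (a (Fin.last n))).map_smul _ _
    have h₃ : ∀ j, cofaceMul (c • ψ) j = c • cofaceMul ψ j := fun j => rfl
    simp only [h₁, h₂, h₃, smul_add, Finset.smul_sum, RingHom.id_apply, smul_comm _ c]

theorem coboundary_apply (M : BanachBimodule A X) (ψ : Cochain A X n) (a : Fin (n + 1) → A) :
    M.coboundary n ψ a = M.left (a 0) (ψ (Fin.tail a))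
      + ∑ j : Fin n, (-1 : ℂ) ^ ((j : ℕ) + 1) • ψ (Fin.contractNth j.castSucc (· * ·) a)
      + (-1 : ℂ) ^ (n + 1) • M.right (a (Fin.last n)) (ψ (Fin.init a)) := by
  simp only [coboundary, LinearMap.coe_mk, AddHom.coe_mk, add_apply, sum_apply, smul_apply]
  rfl

/-- The cofaces as one family, indexed by `0 ≤ i ≤ n + 1`. -/
noncomputable def coface (M : BanachBimodule A X) (ψ : Cochain A X n) (i : ℕ) :
    Cochain A X (n + 1) :=
  if i = 0 then M.cofaceLeft ψ else
    if h : i - 1 < n then cofaceMul ψ ⟨i - 1, h⟩ else M.cofaceRight ψ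

theorem coboundary_eq_sum (M : BanachBimodule A X) (ψ : Cochain A X n) :
    M.coboundary n ψ = ∑ i ∈ Finset.range (n + 2), (-1 : ℂ) ^ i • M.coface ψ i := by
  rw [Finset.sum_range_succ, Finset.sum_range_succ', Finset.sum_range]
  simp [coboundary, coface]
  abel

theorem cofaceLeft_cofaceLeft (M : BanachBimodule A X) (ψ : Cochain A X n) :
    M.cofaceLeft (M.cofaceLeft ψ) = cofaceMul (M.cofaceLeft ψ) 0 := by
  ext a
  exact (M.left_mul _ _ _).symm

theorem cofaceMul_cofaceLeft (M : BanachBimodule A X) (ψ : Cochain A X n) (j : Fin n) :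
    cofaceMul (M.cofaceLeft ψ) j.succ = M.cofaceLeft (cofaceMul ψ j) := by
  ext a
  change M.left _ (ψ _) = M.left _ (ψ _)
  congr 2
  ext m
  simp only [Fin.tail, Fin.contractNth, Fin.val_castSucc, Fin.val_succ]
  split_ifs <;> first | rfl | omega

theorem cofaceRight_cofaceLeft (M : BanachBimodule A X) (ψ : Cochain A X n) :
    M.cofaceRight (M.cofaceLeft ψ) = M.cofaceLeft (M.cofaceRight ψ) := by
  ext a
  exact (M.left_right _ _ _).symm

theorem cofaceRight_cofaceMul (M : BanachBimodule A X) (ψ : Cochain A X n) (j : Fin n) :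
    M.cofaceRight (cofaceMul ψ j) = cofaceMul (M.cofaceRight ψ) j.castSucc := by
  ext a
  change M.right _ (ψ _) = M.right (Fin.contractNth _ _ _ _) (ψ _)
  congr 2
  · simp only [Fin.contractNth, Fin.val_castSucc, Fin.val_last]
    split_ifs <;> first | rfl | omega

theorem cofaceRight_cofaceRight (M : BanachBimodule A X) (ψ : Cochain A X n) :
    M.cofaceRight (M.cofaceRight ψ) = cofaceMul (M.cofaceRight ψ) (Fin.last n) := by
  ext a
  change M.right _ (M.right _ (ψ _)) = M.right (Fin.contractNth _ _ _ _) (ψ _)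
  rw [← M.right_mul]
  congr 2
  · simp [Fin.contractNth, Fin.init]
  ext m
  simp only [Fin.init, Fin.contractNth, Fin.val_castSucc, Fin.val_last]
  split_ifs <;> first | rfl | omega

theorem cofaceMul_cofaceMul (ψ : Cochain A X n) (p : Fin n) (q : Fin n) (hpq : (p : ℕ) ≤ q) :
    cofaceMul (cofaceMul ψ p) q.succ = cofaceMul (cofaceMul ψ q) p.castSucc := by
  ext a
  change ψ _ = ψ _
  congr 1
  ext m
  simp only [Fin.contractNth, Fin.val_castSucc, Fin.val_succ]
  split_ifs <;> first | rfl | exact mul_assoc _ _ _ | exact (mul_assoc _ _ _).symm | omega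

theorem coface_coface (M : BanachBimodule A X) (ψ : Cochain A X n) {i j : ℕ} (hij : i ≤ j)
    (hj : j < n + 2) :
    M.coface (M.coface ψ i) (j + 1) = M.coface (M.coface ψ j) i := by
  rcases Nat.eq_zero_or_pos i with rfl | hi
  · rcases Nat.eq_zero_or_pos j with rfl | hj0
    · simpa [coface] using (M.cofaceLeft_cofaceLeft ψ).symm
    · obtain ⟨j, rfl⟩ : ∃ k, j = k + 1 := ⟨j - 1, by omega⟩
      by_cases h : j < n
      · simpa [coface, h] using M.cofaceMul_cofaceLeft ψ ⟨j, h⟩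
      · simpa [coface, h] using M.cofaceRight_cofaceLeft ψ
  · obtain ⟨i, rfl⟩ : ∃ k, i = k + 1 := ⟨i - 1, by omega⟩
    obtain ⟨j, rfl⟩ : ∃ k, j = k + 1 := ⟨j - 1, by omega⟩
    by_cases h : j < n
    · have h' : i < n := by omega
      have h'' : i < n + 1 := by omega
      simpa [coface, h, h', h''] using cofaceMul_cofaceMul ψ ⟨i, h'⟩ ⟨j, h⟩ (by simpa using hij)
    · by_cases h' : i < n
      · have h'' : i < n + 1 := by omega
        simpa [coface, h, h', h''] using M.cofaceRight_cofaceMul ψ ⟨i, h'⟩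
      · obtain rfl : i = n := by omega
        have e := M.cofaceRight_cofaceRight ψ
        rw [show Fin.last i = ⟨i, Nat.lt_succ_self i⟩ from rfl] at e
        simpa [coface, h] using e

theorem coface_linear (M : BanachBimodule A X) (i : ℕ) :
    ∃ T : Cochain A X n →ₗ[ℂ] Cochain A X (n + 1), ∀ ψ, M.coface ψ i = T ψ := by
  refine ⟨⟨⟨fun ψ => M.coface ψ i, fun ψ χ => ?_⟩, fun c ψ => ?_⟩, fun ψ => rfl⟩
  · simp only [coface]
    split_ifs
    · ext a; exact (M.left (a 0)).map_add _ _
    · rfl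
    · ext a; exact (M.right (a (Fin.last n))).map_add _ _
  · simp only [coface]
    split_ifs
    · ext a; exact (M.left (a 0)).map_smul _ _
    · rfl
    · ext a; exact (M.right (a (Fin.last n))).map_smul _ _

theorem coboundary_coboundary (M : BanachBimodule A X) (ψ : Cochain A X n) :
    M.coboundary (n + 1) (M.coboundary n ψ) = 0 := by
  choose T hT using fun i => M.coface_linear (n := n + 1) i
  have key : M.coboundary (n + 1) (M.coboundary n ψ) =
      ∑ p ∈ Finset.range (n + 3) ×ˢ Finset.range (n + 2),
        (-1 : ℂ) ^ (p.1 + p.2) • M.coface (M.coface ψ p.2) p.1 := by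
    rw [coboundary_eq_sum, Finset.sum_product]
    refine Finset.sum_congr rfl fun j _ => ?_
    rw [hT, coboundary_eq_sum, map_sum, Finset.smul_sum]
    refine Finset.sum_congr rfl fun i _ => ?_
    rw [map_smul, smul_smul, hT, pow_add]
  rw [key]
  refine Finset.sum_involution
    (fun p _ => if p.2 < p.1 then (p.2, p.1 - 1) else (p.2 + 1, p.1)) ?_ ?_ ?_ ?_
  · rintro ⟨j, i⟩ hp
    simp only [Finset.mem_product, Finset.mem_range] at hp
    by_cases h : i < j
    · obtain ⟨j, rfl⟩ : ∃ k, j = k + 1 := ⟨j - 1, by omega⟩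
      simp only [h, if_true, Nat.add_sub_cancel]
      rw [M.coface_coface ψ (by omega) (by omega), ← add_smul]
      convert zero_smul ℂ _
      ring
    · simp only [h, if_false]
      rw [M.coface_coface ψ (i := j) (j := i) (by omega) (by omega), ← add_smul]
      convert zero_smul ℂ _
      ring
  · rintro ⟨j, i⟩ hp _ h
    split_ifs at h <;> simp only [Prod.mk.injEq] at h <;> omega
  · rintro ⟨j, i⟩ hp
    simp only [Finset.mem_product, Finset.mem_range] at hp ⊢
    split_ifs <;> dsimp only at * <;> omega
  · rintro ⟨j, i⟩ hp
    by_cases h : i < j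
    · have : ¬ (j - 1 < i) := by omega
      simp only [h, if_true, this, if_false, Prod.mk.injEq, and_true]
      omega
    · have : j < i + 1 := by omega
      simp [h, this]
/-- The space `Zⁿ(A, X)` of `n`-cocycles. -/
noncomputable def cocycles (M : BanachBimodule A X) (n : ℕ) : Submodule ℂ (Cochain A X n) :=
  LinearMap.ker (M.coboundary n)

/-- The space `Bⁿ(A, X)` of `n`-coboundaries. -/
noncomputable def coboundaries (M : BanachBimodule A X) : (n : ℕ) → Submodule ℂ (Cochain A X n)
  | 0 => ⊥
  | n + 1 => LinearMap.range (M.coboundary n)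

theorem coboundaries_le_cocycles (M : BanachBimodule A X) (n : ℕ) :
    M.coboundaries n ≤ M.cocycles n := by
  cases n with
  | zero => exact bot_le
  | succ n =>
    rintro _ ⟨ψ, rfl⟩
    exact M.coboundary_coboundary ψ

/-- The continuous Hochschild cohomology group `Hⁿ(A, X) = Zⁿ(A, X) / Bⁿ(A, X)`. -/
abbrev HochschildCohomology (M : BanachBimodule A X) (n : ℕ) : Type (max u v) :=
  M.cocycles n ⧸ (M.coboundaries n).submoduleOf (M.cocycles n)

end BanachBimodule

/-! The algebra `ℓ¹(S)` need not be amenable, so one bounded approximate diagonal for all of `S` is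
not available in general. But a tuple of `k` elements of `S` lies, together with the inverses of its
entries, in a Clifford submonoid with `k` generators (in the unitization). There an explicit
approximate diagonal of norm at most `5 ^ k` exists: the product over the generators of averages
over powers, one factor per generator (`exists_approxDiag`). The bound depends on `k` only, and `k`
is governed by the cohomological degree.

As `X` is symmetric, cochains can be evaluated on algebraic chains whose coefficients lie in the
commutative unitization of `S`, and the coboundary is dual to the boundary of these chains
(`evalChain_bd`). Inserting an approximate diagonal into a chain contracts the complex up to small
errors (`bd_insert`, `exists_filling`). Faces of a tuple stay in the submonoid attached to it
(`hull_face_le`), so filling degree by degree gives an equivariant approximate contracting homotopy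
with uniform `ℓ¹` bounds (`exists_approx_homotopy`). Commutativity starts the induction: every
1-cell has boundary zero.

Dually, each cocycle `ψ` lies within `‖ψ‖ / 2` of a coboundary whose primitive is controlled by
`‖ψ‖` (`exists_approx_primitive`). Iterating on the error and summing a geometric series gives an
exact primitive (`exists_preimage_of_approx`). -/

/-! ## Inverses in commutative Clifford semigroups -/

/-- A commutative Clifford semigroup carries a multiplicative operation `s ↦ s⁻¹` for which
`s s⁻¹` is an idempotent fixing both `s` and `s⁻¹`. -/
theorem IsCliffordSemigroup.exists_inverse {S : Type u} [CommSemigroup S]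
    (hS : IsCliffordSemigroup S) :
    ∃ i : S → S, (∀ s, s * i s * s = s) ∧ (∀ s, i s * s * i s = i s) ∧
      ∀ s t, i (s * t) = i s * i t := by
  obtain ⟨L, _, G, _, D, ⟨φ⟩⟩ := hS
  have h : ∀ s : S, ∃ t, s * t * s = s ∧ t * s * t = t := by
    intro s
    set x := φ s with hx
    set y : D.Total := ⟨x.base, x.val⁻¹⟩ with hy
    have h1 : x * y * x = x := by
      refine SemilatticeDiagram.Total.ext_map D (by simp [HMul.hMul, Mul.mul, hy]) ?_
      change D.map _ (D.map _ (D.map _ _ * D.map _ _) * D.map _ _) = _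
      simp only [D.map_map, ← map_mul]
      rw [show x.val * y.val = 1 from mul_inv_cancel _, one_mul, D.map_self]
    have h2 : y * x * y = y := by
      refine SemilatticeDiagram.Total.ext_map D (by simp [HMul.hMul, Mul.mul, hy]) ?_
      change D.map _ (D.map _ (D.map _ _ * D.map _ _) * D.map _ _) = _
      simp only [D.map_map, ← map_mul]
      rw [show y.val * x.val = 1 from inv_mul_cancel _, one_mul, D.map_self]
    refine ⟨φ.symm y, φ.injective ?_, φ.injective ?_⟩
    · simpa using h1
    · simpa using h2
  choose i h1 h2 using h
  -- In a commutative semigroup generalized inverses are unique. Hence the chosen inverses are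
  -- automatically multiplicative.
  have uniq : ∀ x y z : S, x * y * x = x → y * x * y = y → x * z * x = x → z * x * z = z →
      y = z := by
    intro x y z a b c d
    have e1 : y = y * x * z := by
      calc y = y * x * y := b.symm
        _ = y * (x * z * x) * y := by rw [c]
        _ = (y * x * y) * x * z := by ac_rfl
        _ = y * x * z := by rw [b]
    have e2 : z = y * x * z := by
      calc z = z * x * z := d.symm
        _ = z * (x * y * x) * z := by rw [a]
        _ = y * x * (z * x * z) := by ac_rfl
        _ = y * x * z := by rw [d]
    rw [e1, ← e2]
  refine ⟨i, h1, h2, fun s t => uniq (s * t) _ _ (h1 _) (h2 _) ?_ ?_⟩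
  · rw [show s * t * (i s * i t) * (s * t) = (s * i s * s) * (t * i t * t) by ac_rfl, h1, h1]
  · rw [show i s * i t * (s * t) * (i s * i t) = (i s * s * i s) * (i t * t * i t) by ac_rfl,
      h2, h2]

/-! ## The `ℓ¹` norm on finitely supported functions -/

namespace Finsupp

variable {ι : Type*}

/-- The `ℓ¹` norm of a finitely supported function. -/
noncomputable def l1 : Seminorm ℂ (ι →₀ ℂ) :=
  Seminorm.of (fun x => x.sum fun _ c => ‖c‖)
    (fun x y => by
      classical
      rw [Finsupp.sum_of_support_subset x (Finset.subset_union_left (s₂ := y.support)) _ (by simp),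
        Finsupp.sum_of_support_subset y (Finset.subset_union_right (s₁ := x.support)) _ (by simp),
        Finsupp.sum_of_support_subset (x + y) Finsupp.support_add _ (by simp),
        ← Finset.sum_add_distrib]
      exact Finset.sum_le_sum fun i _ => norm_add_le _ _)
    (fun c x => by
      rw [Finsupp.sum_smul_index' (by simp), Finsupp.sum, Finsupp.sum, Finset.mul_sum]
      simp)

theorem l1_apply (x : ι →₀ ℂ) : l1 x = x.sum fun _ c => ‖c‖ := rfl

@[simp]
theorem l1_single (i : ι) (c : ℂ) : l1 (single i c) = ‖c‖ := by
  simp [l1_apply]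

/-- The bound is asked on the support only, because approximate centrality will be available for
finitely many elements at a time. A general seminorm covers both the `ℓ¹` norm and the norm of `X`.
-/
theorem seminorm_linearCombination_le {V : Type*} [AddCommGroup V] [Module ℂ V]
    (p : Seminorm ℂ V) {f : ι → V} {C : ℝ} (x : ι →₀ ℂ) (hf : ∀ i ∈ x.support, p (f i) ≤ C) :
    p (linearCombination ℂ f x) ≤ C * l1 x := by
  rw [linearCombination_apply, l1_apply, Finsupp.sum, Finsupp.sum, Finset.mul_sum]
  refine (Finset.le_sum_of_subadditive p (map_zero p).le (map_add_le_add p) _ _).trans (Finset.sum_le_sum fun i hi => ?_)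
  rw [map_smul_eq_mul, mul_comm]
  exact mul_le_mul_of_nonneg_right (hf i hi) (norm_nonneg _)

theorem linearCombination_mem {V : Type*} [AddCommGroup V] [Module ℂ V] (W : Submodule ℂ V)
    {f : ι → V} (x : ι →₀ ℂ) (hf : ∀ i ∈ x.support, f i ∈ W) : linearCombination ℂ f x ∈ W := by
  rw [linearCombination_apply]
  exact W.sum_mem fun i hi => W.smul_mem _ (hf i hi)

end Finsupp

/-! ### The submultiplicative `ℓ¹` norm on a monoid algebra -/

namespace MonoidAlgebra

variable {Q : Type*} [Monoid Q]

/-- The `ℓ¹` norm on a monoid algebra. -/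
noncomputable def l1 : Seminorm ℂ (MonoidAlgebra ℂ Q) :=
  Finsupp.l1.comp (coeffLinearEquiv ℂ).toLinearMap

theorem l1_apply (x : MonoidAlgebra ℂ Q) : l1 x = Finsupp.l1 x.coeff := rfl

@[simp]
theorem l1_single (q : Q) (c : ℂ) : l1 (single q c) = ‖c‖ := by
  rw [l1_apply, coeff_single, Finsupp.l1_single]

/-- Translation by a monoid element permutes or merges basis vectors, so it is contractive; the
product is a combination of translates of `y`. -/
theorem l1_mul_le (x y : MonoidAlgebra ℂ Q) : l1 (x * y) ≤ l1 x * l1 y := by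
  have h (q : Q) : l1 (single q 1 * y) ≤ l1 y := by
    have e : single q 1 * y =
        Finsupp.linearCombination ℂ (fun r => single (q * r) (1 : ℂ)) y.coeff := by
      rw [mul_def, Finsupp.linearCombination_apply]
      simp
    rw [e]
    simpa [l1_apply y] using Finsupp.seminorm_linearCombination_le l1 (C := 1) y.coeff
      (f := fun r => single (q * r) (1 : ℂ)) (by simp)
  have e : x * y = Finsupp.linearCombination ℂ (fun q => single q (1 : ℂ) * y) x.coeff := by
    rw [Finsupp.linearCombination_apply]
    simp only [mul_def, Finsupp.smul_sum]
    simp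
  rw [e, mul_comm, l1_apply x]
  exact Finsupp.seminorm_linearCombination_le l1 x.coeff fun q _ => h q

theorem l1_one : l1 (1 : MonoidAlgebra ℂ Q) = 1 := by
  rw [one_def, l1_single, norm_one]

theorem l1_pow_le_one {x : MonoidAlgebra ℂ Q} (hx : l1 x ≤ 1) (n : ℕ) : l1 (x ^ n) ≤ 1 := by
  induction n with
  | zero => rw [pow_zero, l1_one]
  | succ n ih =>
    rw [pow_succ]
    exact (l1_mul_le _ _).trans (mul_le_one₀ ih (apply_nonneg _ _) hx)

theorem l1_prod_le {k : Type*} {Q : Type*} [CommMonoid Q] (s : Finset k)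
    (x : k → MonoidAlgebra ℂ Q) {C : ℝ} (hx : ∀ i ∈ s, l1 (x i) ≤ C) (hC : 0 ≤ C) :
    l1 (∏ i ∈ s, x i) ≤ C ^ s.card := by
  classical
  induction s using Finset.induction_on with
  | empty => simp [l1_one]
  | insert a s ha ih =>
    rw [Finset.prod_insert ha, Finset.card_insert_of_notMem ha, pow_succ']
    exact (l1_mul_le _ _).trans (mul_le_mul (hx _ (Finset.mem_insert_self _ _))
      (ih fun i hi => hx i (Finset.mem_insert_of_mem hi)) (apply_nonneg _ _) hC)

end MonoidAlgebra

/-! ## Approximate diagonals -/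

namespace ApproxDiag

open MonoidAlgebra

variable {P : Type*} [CommMonoid P]

/-- The element `p ⊗ q` of the enveloping algebra. -/
noncomputable abbrev tens (p q : P) : MonoidAlgebra ℂ (P × P) := single (p, q) 1

theorem tens_mul (p q p' q' : P) : tens p q * tens p' q' = tens (p * p') (q * q') := by
  simp [tens, single_mul_single]

/-- The multiplication map of the enveloping algebra. -/
noncomputable def mulMap : MonoidAlgebra ℂ (P × P) →ₐ[ℂ] MonoidAlgebra ℂ P :=
  mapDomainAlgHom ℂ ℂ mulMonoidHom

@[simp]
theorem mulMap_single (p : P × P) (c : ℂ) : mulMap (single p c) = single (p.1 * p.2) c := by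
  simp [mulMap]

/-- The elements of the enveloping algebra whose second tensor factor is supported in `T`. -/
noncomputable def sndSupported (T : Submonoid P) : Subalgebra ℂ (MonoidAlgebra ℂ (P × P)) :=
  (mapDomainAlgHom ℂ ℂ (Submonoid.prod ⊤ T).subtype).range

theorem tens_mem {T : Submonoid P} (p : P) {q : P} (hq : q ∈ T) : tens p q ∈ sndSupported T :=
  ⟨single ⟨(p, q), ⟨trivial, hq⟩⟩ 1, by simp⟩

theorem mem_of_mem_support {T : Submonoid P} {x : MonoidAlgebra ℂ (P × P)}
    (hx : x ∈ sndSupported T) {p : P × P} (hp : p ∈ x.coeff.support) : p.2 ∈ T := by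
  classical
  obtain ⟨y, rfl⟩ := hx
  obtain ⟨q, -, rfl⟩ := Finset.mem_image.1 (Finsupp.mapDomain_support hp)
  exact q.2.2

/-- The averaged diagonal for the Clifford monoid generated by `z`, with inverse `w` and
`e = z w`: it is `(1 - e) ⊗ (1 - e)` plus the average of the `e w ^ h ⊗ e z ^ h` for `h < N`. -/
noncomputable def cyclic (z w : P) (N : ℕ) : MonoidAlgebra ℂ (P × P) :=
  (1 - tens (z * w) 1) * (1 - tens 1 (z * w)) +
    (N : ℂ)⁻¹ • (tens (z * w) (z * w) * ∑ h ∈ Finset.range N, tens w z ^ h)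

theorem l1_tens (p q : P) : l1 (tens p q) = 1 := by
  rw [l1_single, norm_one]

theorem l1_one_sub_tens_le (p q : P) : l1 (1 - tens p q) ≤ 2 := by
  refine (map_sub_le_add l1 _ _).trans ?_
  rw [l1_one, l1_tens]
  norm_num

/-- The idempotent part contributes `2 * 2` and the average at most `1`, independently of `N`. -/
theorem l1_cyclic_le (z w : P) (N : ℕ) : l1 (cyclic z w N) ≤ 5 := by
  refine (map_add_le_add l1 _ _).trans ?_
  have h1 : l1 ((1 - tens (z * w) 1) * (1 - tens 1 (z * w))) ≤ 4 := by
    refine (l1_mul_le _ _).trans ?_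
    nlinarith [l1_one_sub_tens_le (z * w) 1, l1_one_sub_tens_le 1 (z * w),
      apply_nonneg (l1 (Q := P × P)) (1 - tens (z * w) 1), apply_nonneg (l1 (Q := P × P)) (1 - tens 1 (z * w))]
  have h2 : l1 (tens (z * w) (z * w) * ∑ h ∈ Finset.range N, tens w z ^ h) ≤ N := by
    refine (l1_mul_le _ _).trans ?_
    rw [l1_tens, one_mul]
    refine (Finset.le_sum_of_subadditive l1 (map_zero l1).le (map_add_le_add l1) _ _).trans ?_
    refine (Finset.sum_le_card_nsmul _ _ 1 fun h _ => l1_pow_le_one (l1_tens _ _).le h).trans ?_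
    simp
  have h3 : l1 ((N : ℂ)⁻¹ • (tens (z * w) (z * w) * ∑ h ∈ Finset.range N, tens w z ^ h)) ≤ 1 := by
    rw [map_smul_eq_mul, norm_inv, Complex.norm_natCast]
    refine (mul_le_mul_of_nonneg_left h2 (by positivity)).trans ?_
    exact inv_mul_le_one
  linarith

theorem idem {z w : P} (hz : z * w * z = z) : z * w * (z * w) = z * w := by rw [← mul_assoc, hz]

/-- With `e = z w`, multiplication sends the first summand to `(1 - e)² = 1 - e` and every term of
the average to `e`. -/
theorem mulMap_cyclic {z w : P} (hz : z * w * z = z) {N : ℕ} (hN : N ≠ 0) : mulMap (cyclic z w N) = 1 := by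
  have h (n : ℕ) : single (z * w) (1 : ℂ) * single (w * z) (1 : ℂ) ^ n = single (z * w) 1 := by
    induction n with
    | zero => simp
    | succ n ih =>
      rw [pow_succ, ← mul_assoc, ih, single_mul_single, mul_comm w z, idem hz, one_mul]
  have hN' : (N : ℂ) ≠ 0 := by exact_mod_cast hN
  simp only [cyclic, map_add, map_mul, map_sub, map_one, map_smul, map_sum, map_pow,
    mulMap_single, one_mul, mul_one, Finset.mul_sum, idem hz, h]
  rw [Finset.sum_const, Finset.card_range, ← Nat.cast_smul_eq_nsmul ℂ, smul_smul,
    inv_mul_cancel₀ hN', one_smul, mul_sub, mul_one, sub_mul, single_mul_single, idem hz]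
  simp

theorem tens_pow (p q : P) (n : ℕ) : tens p q ^ n = tens (p ^ n) (q ^ n) := by
  simp [tens, single_pow]

/-- The commutator `y` kills the idempotent part, and against the average it telescopes to two end
terms, whence `2 / N`. The alternatives in `hab` serve the generator and its inverse, for which `w ⊗
z` shifts in opposite directions. -/
theorem l1_central_cyclic_aux {z w : P} {y : MonoidAlgebra ℂ (P × P)} {a b : MonoidAlgebra ℂ (P × P)}
    (N : ℕ) (ha : l1 a ≤ 1) (hab : b = a * tens w z ∨ a = b * tens w z) (hb : l1 b ≤ 1)
    (hy : y * ((1 - tens (z * w) 1) * (1 - tens 1 (z * w))) = 0)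
    (hy' : y * tens (z * w) (z * w) = a - b) : l1 (y * cyclic z w N) ≤ 2 / N := by
  have key (c : MonoidAlgebra ℂ (P × P)) (hc : l1 c ≤ 1) :
      l1 ((c - c * tens w z) * ∑ h ∈ Finset.range N, tens w z ^ h) ≤ 2 := by
    have e : (c - c * tens w z) * ∑ h ∈ Finset.range N, tens w z ^ h =
        c * (1 - tens w z ^ N) := by
      rw [← mul_neg_geom_sum]
      ring
    rw [e]
    refine (l1_mul_le _ _).trans ?_
    rw [tens_pow]
    nlinarith [l1_one_sub_tens_le (w ^ N) (z ^ N), apply_nonneg (l1 (Q := P × P)) c,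
      apply_nonneg (l1 (Q := P × P)) (1 - tens (w ^ N) (z ^ N))]
  have h2 : l1 ((a - b) * ∑ h ∈ Finset.range N, tens w z ^ h) ≤ 2 := by
    rcases hab with h | h
    · rw [h]
      exact key a ha
    · rw [← map_neg_eq_map, ← neg_mul, neg_sub, h]
      exact key b hb
  rw [cyclic, mul_add, hy, zero_add, mul_smul_comm, ← mul_assoc, hy', map_smul_eq_mul, norm_inv,
    Complex.norm_natCast, div_eq_inv_mul]
  exact mul_le_mul_of_nonneg_left h2 (by positivity)

theorem l1_central_cyclic_left {z w : P} (hz : z * w * z = z) (N : ℕ) :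
    l1 ((tens z 1 - tens 1 z) * cyclic z w N) ≤ 2 / N := by
  have e2 : z * (z * w) = z := by rw [mul_comm, hz]
  refine l1_central_cyclic_aux N (a := tens z (z * w)) (b := tens (z * w) z)
    (l1_tens _ _).le (Or.inl ?_) (l1_tens _ _).le ?_ ?_
  · rw [tens_mul, mul_comm (z * w) z, e2]
  · have h1 : tens z (1 : P) * (1 - tens (z * w) 1) = 0 := by
      rw [mul_sub, mul_one, tens_mul, e2, one_mul, sub_self]
    have h2 : tens (1 : P) z * (1 - tens 1 (z * w)) = 0 := by
      rw [mul_sub, mul_one, tens_mul, e2, one_mul, sub_self]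
    linear_combination (1 - tens 1 (z * w)) * h1 - (1 - tens (z * w) 1) * h2
  · rw [sub_mul, tens_mul, tens_mul, e2, one_mul]

theorem l1_central_cyclic_right {z w : P} (hw : w * z * w = w) (N : ℕ) :
    l1 ((tens w 1 - tens 1 w) * cyclic z w N) ≤ 2 / N := by
  have e1 : w * (z * w) = w := by rw [← mul_assoc, hw]
  refine l1_central_cyclic_aux N (a := tens w (z * w)) (b := tens (z * w) w)
    (l1_tens _ _).le (Or.inr ?_) (l1_tens _ _).le ?_ ?_
  · rw [tens_mul, mul_comm (z * w) w, e1, mul_comm w z]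
  · have h1 : tens w (1 : P) * (1 - tens (z * w) 1) = 0 := by
      rw [mul_sub, mul_one, tens_mul, e1, one_mul, sub_self]
    have h2 : tens (1 : P) w * (1 - tens 1 (z * w)) = 0 := by
      rw [mul_sub, mul_one, tens_mul, e1, one_mul, sub_self]
    linear_combination (1 - tens 1 (z * w)) * h1 - (1 - tens (z * w) 1) * h2
  · rw [sub_mul, tens_mul, tens_mul, e1, one_mul]

theorem cyclic_mem {T : Submonoid P} {z w : P} (hz : z ∈ T) (hw : w ∈ T) (N : ℕ) :
    cyclic z w N ∈ sndSupported T := by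
  have hzw := T.mul_mem hz hw
  refine add_mem (mul_mem (sub_mem (one_mem _) (tens_mem _ T.one_mem))
    (sub_mem (one_mem _) (tens_mem _ hzw))) (Subalgebra.smul_mem _ (mul_mem (tens_mem _ hzw)
      (sum_mem fun h _ => pow_mem (tens_mem _ hz) h)) _)

/-- The submonoid of elements asymptotically central with rate `1 / N` for a family of elements
of the enveloping algebra. -/
noncomputable def centralizing (Δ : ℕ → MonoidAlgebra ℂ (P × P)) : Submonoid P where
  -- At `N = 0` the right side is `0`. This is harmless: the average in `cyclic` then disappears,
  -- and the generators commute exactly with what is left.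
  carrier := {t | ∃ C : ℝ, ∀ N : ℕ, l1 ((tens t 1 - tens 1 t) * Δ N) ≤ C / N}
  one_mem' := ⟨0, fun N => by simp⟩
  mul_mem' := by
    rintro s t ⟨C, hC⟩ ⟨C', hC'⟩
    refine ⟨C + C', fun N => ?_⟩
    -- The commutator obeys a Leibniz rule, and `p ⊗ q` acts contractively, so the constants add.
    have e : (tens (s * t) 1 - tens 1 (s * t)) * Δ N =
        tens s 1 * ((tens t 1 - tens 1 t) * Δ N) + tens 1 t * ((tens s 1 - tens 1 s) * Δ N) := by
      have h1 : tens (s * t) (1 : P) = tens s 1 * tens t 1 := by rw [tens_mul, mul_one]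
      have h2 : tens (1 : P) (s * t) = tens 1 s * tens 1 t := by rw [tens_mul, mul_one]
      rw [h1, h2]
      ring
    have h (p q : P) (x : MonoidAlgebra ℂ (P × P)) : l1 (tens p q * x) ≤ l1 x := by
      simpa only [l1_tens, one_mul] using l1_mul_le (tens p q) x
    rw [e, add_div, add_comm (C / N)]
    refine (map_add_le_add l1 _ _).trans (add_le_add ((h _ _ _).trans (hC' N))
      ((h _ _ _).trans (hC N))) |>.trans_eq ?_
    rfl

/-- In the submonoid generated by finitely many elements `z i` and their generalized inverses `w i`
there are approximate diagonals with norms bounded in terms of the number of generators only. -/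
theorem exists_approxDiag {k : Type*} [Fintype k] (z w : k → P)
    (hz : ∀ i, z i * w i * z i = z i) (hw : ∀ i, w i * z i * w i = w i)
    {T : Submonoid P} (hT : T = Submonoid.closure (Set.range z ∪ Set.range w))
    (F : Finset P) (hF : ∀ t ∈ F, t ∈ T) {ε : ℝ} (hε : 0 < ε) :
    ∃ Δ ∈ sndSupported T, l1 Δ ≤ 5 ^ Fintype.card k ∧ mulMap Δ = 1 ∧
      ∀ t ∈ F, l1 ((tens t 1 - tens 1 t) * Δ) ≤ ε := by
  classical
  let Δ : ℕ → MonoidAlgebra ℂ (P × P) := fun N => ∏ i, cyclic (z i) (w i) N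
  have hcent : T ≤ centralizing Δ := by
    -- The enveloping algebra is commutative, so the `i`-th factor can be moved next to `y`; the
    -- others cost only a constant independent of `N`.
    have key (i : k) (N : ℕ) (y : MonoidAlgebra ℂ (P × P))
        (hy : l1 (y * cyclic (z i) (w i) N) ≤ 2 / N) :
        l1 (y * Δ N) ≤ (2 * 5 ^ (Finset.univ.erase i).card : ℝ) / N := by
      simp only [Δ]
      rw [← Finset.mul_prod_erase _ _ (Finset.mem_univ i), ← mul_assoc, mul_div_right_comm]
      exact (l1_mul_le _ _).trans (mul_le_mul hy
        (l1_prod_le _ _ (fun j _ => l1_cyclic_le _ _ _) (by norm_num)) (apply_nonneg _ _)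
        (by positivity))
    rw [hT, Submonoid.closure_le]
    rintro _ (⟨i, rfl⟩ | ⟨i, rfl⟩)
    · exact ⟨_, fun N => key i N _ (l1_central_cyclic_left (hz i) N)⟩
    · exact ⟨_, fun N => key i N _ (l1_central_cyclic_right (hw i) N)⟩
  have hev : ∀ t ∈ F, ∀ᶠ N : ℕ in Filter.atTop, l1 ((tens t 1 - tens 1 t) * Δ N) ≤ ε := by
    intro t ht
    obtain ⟨C, hC⟩ := hcent (hF t ht)
    filter_upwards [(tendsto_const_div_atTop_nhds_zero_nat C).eventually_le_const hε] with N hN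
    exact (hC N).trans hN
  -- Enlarging `N` improves centrality on `F` without affecting the norm bound, which is why that
  -- bound involves neither `F` nor `ε`.
  obtain ⟨N, hN, hN0⟩ := (((Filter.eventually_all_finset F).2 hev).and
    (Filter.eventually_ne_atTop 0)).exists
  refine ⟨Δ N, ?_, ?_, ?_, hN⟩
  · refine prod_mem fun i _ => cyclic_mem ?_ ?_ N <;> rw [hT] <;>
      exact Submonoid.subset_closure (by simp)
  · exact l1_prod_le Finset.univ _ (fun j _ => l1_cyclic_le _ _ _) (by norm_num)
  · simp only [Δ, map_prod, mulMap_cyclic (hz _) hN0, Finset.prod_const_one]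

end ApproxDiag

/-! ## The cyclic chain complex of a commutative semigroup -/

namespace SymChain

open Finsupp

variable {S : Type u} [CommSemigroup S] {n : ℕ}

variable (S) in
/-- Generators in degree `n` of the Hochschild complex of a commutative semigroup `S` with
coefficients in its unitization. -/
abbrev Cell (n : ℕ) : Type u := WithOne S × (Fin n → S)

variable (S) in
/-- The (algebraic) Hochschild chains of `S` with coefficients in its unitization. -/
abbrev Chain (n : ℕ) : Type u := Cell S n →₀ ℂ

/-- The `i`-th face of a cell, for `0 ≤ i ≤ n + 1`. -/
def face (i : ℕ) (c : Cell S (n + 1)) : Cell S n :=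
  if i = 0 then (c.1 * c.2 0, Fin.tail c.2) else
    if h : i - 1 < n then (c.1, Fin.contractNth (Fin.castSucc ⟨i - 1, h⟩) (· * ·) c.2)
    else (c.1 * c.2 (Fin.last n), Fin.init c.2)

theorem face_zero (c : Cell S (n + 1)) : face 0 c = (c.1 * c.2 0, Fin.tail c.2) := rfl

theorem face_succ (j : Fin n) (c : Cell S (n + 1)) :
    face (j + 1) c = (c.1, Fin.contractNth j.castSucc (· * ·) c.2) := by
  simp [face]

theorem face_last (c : Cell S (n + 1)) :
    face (n + 1) c = (c.1 * c.2 (Fin.last n), Fin.init c.2) := by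
  simp [face]

/-- These are the simplicial identities. The zeroth and the last face act on the coefficient from
the same side, so the cases involving the last face rest on commutativity of `S`. -/
theorem face_face {i j : ℕ} (hij : i ≤ j) (hj : j < n + 2) (c : Cell S (n + 2)) :
    face i (face (j + 1) c) = face j (face i c) := by
  obtain ⟨m, s⟩ := c
  rcases Nat.eq_zero_or_pos i with rfl | hi
  · rcases Nat.eq_zero_or_pos j with rfl | hj0
    · refine Prod.ext ?_ rfl
      simp [face, Fin.contractNth, mul_assoc, Fin.tail]
    · obtain ⟨j, rfl⟩ : ∃ k, j = k + 1 := ⟨j - 1, by omega⟩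
      by_cases h : j < n
      · refine Prod.ext ?_ (funext fun m => ?_)
        · simp [face, h, Fin.contractNth]
        · simp [face, h, Fin.tail, Fin.contractNth]
      · refine Prod.ext ?_ ?_
        · simp [face, h, Fin.tail, Fin.init, mul_assoc]
          exact congrArg _ (mul_comm _ _)
        · simp [face, h]
          rfl
  · obtain ⟨i, rfl⟩ : ∃ k, i = k + 1 := ⟨i - 1, by omega⟩
    obtain ⟨j, rfl⟩ : ∃ k, j = k + 1 := ⟨j - 1, by omega⟩
    by_cases h : j < n
    · have h' : i < n := by omega
      have h'' : i < n + 1 := by omega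
      refine Prod.ext ?_ (funext fun m => ?_)
      · simp [face, h, h', h'']
      · simp only [face, h, h', h'', Nat.add_sub_cancel, Nat.add_lt_add_iff_right]
        simp only [Nat.succ_ne_zero, dif_pos, if_false, Fin.contractNth, Fin.val_castSucc,
          Fin.val_succ]
        split_ifs <;> first | rfl | exact mul_assoc _ _ _ | exact (mul_assoc _ _ _).symm | omega
    · by_cases h' : i < n
      · have h'' : i < n + 1 := by omega
        refine Prod.ext ?_ (funext fun m => ?_)
        · simp [face, h, h', h'', Fin.contractNth]
          rw [if_neg (by omega), if_neg (by omega)]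
        · simp [face, h, h', h'', Fin.init, Fin.contractNth]
      · obtain rfl : i = n := by omega
        refine Prod.ext ?_ (funext fun m => ?_)
        · simp [face, h, Fin.init, Fin.contractNth]
          rw [mul_assoc]
          exact congrArg _ (mul_comm _ _)
        · simp [face, h, Fin.init, Fin.contractNth]

/-- The boundary operator. -/
noncomputable def bd : Chain S (n + 1) →ₗ[ℂ] Chain S n :=
  linearCombination ℂ fun c => ∑ i ∈ Finset.range (n + 2), (-1 : ℂ) ^ i • single (face i c) (1 : ℂ)

theorem bd_single (c : Cell S (n + 1)) : bd (single c 1) =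
    ∑ i ∈ Finset.range (n + 2), (-1 : ℂ) ^ i • single (face i c) (1 : ℂ) := by
  simp [bd]

theorem bd_single_eq (c : Cell S (n + 1)) : bd (single c 1) =
    single (c.1 * c.2 0, Fin.tail c.2) 1 +
      ∑ j : Fin n, (-1 : ℂ) ^ ((j : ℕ) + 1) •
        single (c.1, Fin.contractNth j.castSucc (· * ·) c.2) (1 : ℂ) +
      (-1 : ℂ) ^ (n + 1) • single (c.1 * c.2 (Fin.last n), Fin.init c.2) 1 := by
  rw [bd_single, Finset.sum_range_succ, Finset.sum_range_succ', Finset.sum_range, face_last]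
  simp only [face_succ, pow_zero, one_smul, face_zero]
  abel

theorem l1_bd_le (x : Chain S (n + 1)) : l1 (bd x) ≤ (n + 2) * l1 x := by
  refine seminorm_linearCombination_le l1 x fun c _ => ?_
  refine (Finset.le_sum_of_subadditive l1 (map_zero l1).le (map_add_le_add l1) _ _).trans ?_
  refine (Finset.sum_le_card_nsmul _ _ 1 fun i _ => ?_).trans ?_
  · simp
  · simp

theorem bd_bd (x : Chain S (n + 2)) : bd (bd x) = 0 := by
  suffices h : bd ∘ₗ bd = (0 : Chain S (n + 2) →ₗ[ℂ] Chain S n) from DFunLike.congr_fun h x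
  ext1 c
  ext1
  change bd (bd (single c 1)) = 0
  have key : bd (bd (single c (1 : ℂ))) =
      ∑ p ∈ Finset.range (n + 3) ×ˢ Finset.range (n + 2),
        (-1 : ℂ) ^ (p.1 + p.2) • single (face p.2 (face p.1 c)) (1 : ℂ) := by
    rw [bd_single, Finset.sum_product, map_sum]
    refine Finset.sum_congr rfl fun j _ => ?_
    rw [map_smul, bd_single, Finset.smul_sum]
    refine Finset.sum_congr rfl fun i _ => ?_
    rw [smul_smul, pow_add]
  rw [key]
  -- The involution matches the face pairs `(j + 1, i)` and `(i, j)` for `i ≤ j`: they give the same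
  -- cell with opposite signs.
  refine Finset.sum_involution
    (fun p _ => if p.2 < p.1 then (p.2, p.1 - 1) else (p.2 + 1, p.1)) ?_ ?_ ?_ ?_
  · rintro ⟨j, i⟩ hp
    simp only [Finset.mem_product, Finset.mem_range] at hp
    by_cases h : i < j
    · obtain ⟨j, rfl⟩ : ∃ k, j = k + 1 := ⟨j - 1, by omega⟩
      simp only [h, if_true, Nat.add_sub_cancel]
      rw [face_face (i := i) (j := j) (by omega) (by omega), ← add_smul]
      convert zero_smul ℂ _
      ring
    · simp only [h, if_false]
      rw [face_face (i := j) (j := i) (by omega) (by omega), ← add_smul]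
      convert zero_smul ℂ _
      ring
  · rintro ⟨j, i⟩ hp _ h
    split_ifs at h <;> simp only [Prod.mk.injEq] at h <;> omega
  · rintro ⟨j, i⟩ hp
    simp only [Finset.mem_product, Finset.mem_range] at hp ⊢
    split_ifs <;> dsimp only at * <;> omega
  · rintro ⟨j, i⟩ hp
    by_cases h : i < j
    · have : ¬ (j - 1 < i) := by omega
      simp only [h, if_true, this, if_false, Prod.mk.injEq, and_true]
      omega
    · have : j < i + 1 := by omega
      simp [h, this]

/-- Multiplication of the coefficients of a chain by an element of the unitization. -/
noncomputable def act (p : WithOne S) : Chain S n →ₗ[ℂ] Chain S n :=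
  linearCombination ℂ fun c => single (p * c.1, c.2) 1

@[simp]
theorem act_single (p : WithOne S) (c : Cell S n) :
    act p (single c 1) = single (p * c.1, c.2) 1 := by
  simp [act]

theorem l1_act_le (p : WithOne S) (x : Chain S n) : l1 (act p x) ≤ l1 x := by
  refine (seminorm_linearCombination_le l1 (C := 1) x fun c _ => ?_).trans_eq (one_mul _)
  rw [l1_single, norm_one]

theorem act_mul (p q : WithOne S) (x : Chain S n) : act (p * q) x = act p (act q x) := by
  suffices h : act (p * q) = act p ∘ₗ (act q : Chain S n →ₗ[ℂ] Chain S n) from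
    DFunLike.congr_fun h x
  ext1 c
  ext1
  change act (p * q) (single c 1) = act p (act q (single c 1))
  simp only [act_single, mul_assoc]

theorem face_act (i : ℕ) (p m : WithOne S) (s : Fin (n + 1) → S) :
    face i (p * m, s) = (p * (face i (m, s)).1, (face i (m, s)).2) := by
  unfold face
  split_ifs <;> simp [mul_assoc]

theorem bd_act (p : WithOne S) (x : Chain S (n + 1)) : bd (act p x) = act p (bd x) := by
  suffices h : bd ∘ₗ act p = act p ∘ₗ (bd : Chain S (n + 1) →ₗ[ℂ] Chain S n) from
    DFunLike.congr_fun h x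
  ext1 c
  ext1
  change bd (act p (single c 1)) = act p (bd (single c 1))
  simp only [act_single, bd_single, map_sum, map_smul, face_act]

/-- The equivariant extension of a family of chains indexed by tuples. -/
noncomputable def extend {k : ℕ} (σ : (Fin n → S) → Chain S k) : Chain S n →ₗ[ℂ] Chain S k :=
  linearCombination ℂ fun c => act c.1 (σ c.2)

@[simp]
theorem extend_single {k : ℕ} (σ : (Fin n → S) → Chain S k) (c : Cell S n) :
    extend σ (single c 1) = act c.1 (σ c.2) := by
  simp [extend]

theorem l1_extend_le {k : ℕ} {σ : (Fin n → S) → Chain S k} {C : ℝ} (h : ∀ s, l1 (σ s) ≤ C)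
    (x : Chain S n) : l1 (extend σ x) ≤ C * l1 x :=
  seminorm_linearCombination_le l1 x fun _ _ => (l1_act_le _ _).trans (h _)

theorem extend_act {k : ℕ} (σ : (Fin n → S) → Chain S k) (p : WithOne S) (x : Chain S n) :
    extend σ (act p x) = act p (extend σ x) := by
  suffices h : extend σ ∘ₗ act p = act p ∘ₗ extend σ from DFunLike.congr_fun h x
  ext1 c
  ext1
  change extend σ (act p (single c 1)) = act p (extend σ (single c 1))
  simp only [act_single, extend_single, act_mul]

/-- Chains whose cells have all their entries in `T`. -/
def within (T : Submonoid (WithOne S)) : Submodule ℂ (Chain S n) :=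
  supported ℂ ℂ {c | ∀ i, (c.2 i : WithOne S) ∈ T}

theorem mem_within {T : Submonoid (WithOne S)} {x : Chain S n} :
    x ∈ within T ↔ ∀ c ∈ x.support, ∀ i, (c.2 i : WithOne S) ∈ T := by
  simp [within, mem_supported, Set.subset_def]

theorem single_mem_within {T : Submonoid (WithOne S)} {c : Cell S n}
    (h : ∀ i, (c.2 i : WithOne S) ∈ T) (a : ℂ) : single c a ∈ within T :=
  single_mem_supported ℂ a h

theorem within_mono {T T' : Submonoid (WithOne S)} (h : T ≤ T') :
    (within T : Submodule ℂ (Chain S n)) ≤ within T' :=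
  supported_mono fun _c hc i => h (hc i)

theorem face_mem {T : Submonoid (WithOne S)} {c : Cell S (n + 1)}
    (hc : ∀ j, (c.2 j : WithOne S) ∈ T) (i : ℕ) (j : Fin n) :
    ((face i c).2 j : WithOne S) ∈ T := by
  unfold face
  split_ifs
  · exact hc _
  · dsimp only [Fin.contractNth]
    split_ifs
    · exact hc _
    · rw [WithOne.coe_mul]
      exact T.mul_mem (hc _) (hc _)
    · exact hc _
  · exact hc _

theorem act_mem_within {T : Submonoid (WithOne S)} {x : Chain S n} (hx : x ∈ within T)
    (p : WithOne S) : act p x ∈ within T :=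
  linearCombination_mem _ x fun c hc =>
    single_mem_within (c := (p * c.1, c.2)) (mem_within.1 hx c hc) 1

end SymChain

/-! ### Contraction of chains by elements of the enveloping algebra -/

namespace SymChain

open Finsupp ApproxDiag

variable {S : Type u} [CommSemigroup S] {n : ℕ}

/-- Insertion of `b ⊗ a` between the coefficient and the first entry of a cell: the coefficient is
multiplied by `b`, and `a` becomes the first entry. The result is degenerate if `a = 1`. -/
noncomputable def insertCell (p : WithOne S × WithOne S) (c : Cell S n) : Chain S (n + 1) :=
  WithOne.recOneCoe (motive := fun _ => Chain S (n + 1)) 0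
    (fun a => single (c.1 * p.1, Fin.cons a c.2) 1) p.2

@[simp]
theorem insertCell_one (b : WithOne S) (c : Cell S n) : insertCell (b, 1) c = 0 := rfl

@[simp]
theorem insertCell_coe (b : WithOne S) (a : S) (c : Cell S n) :
    insertCell (b, (a : WithOne S)) c = single (c.1 * b, Fin.cons a c.2) 1 := rfl

/-- Insertion of an element of the enveloping algebra in a chain. -/
noncomputable def insert :
    MonoidAlgebra ℂ (WithOne S × WithOne S) →ₗ[ℂ] Chain S n →ₗ[ℂ] Chain S (n + 1) :=
  (linearCombination ℂ fun p => linearCombination ℂ (insertCell p)) ∘ₗ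
    (MonoidAlgebra.coeffLinearEquiv ℂ).toLinearMap

@[simp]
theorem insert_single (p : WithOne S × WithOne S) (a : ℂ) (c : Cell S n) :
    insert (MonoidAlgebra.single p a) (single c 1) = a • insertCell p c := by
  simp [insert]

theorem l1_insert_le (Δ : MonoidAlgebra ℂ (WithOne S × WithOne S)) (x : Chain S n) :
    l1 (insert Δ x) ≤ MonoidAlgebra.l1 Δ * l1 x := by
  have h (p) : l1 (linearCombination ℂ (insertCell p) x) ≤ l1 x := by
    refine (seminorm_linearCombination_le l1 (C := 1) x fun c _ => ?_).trans_eq (one_mul _)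
    obtain ⟨b, a⟩ := p
    induction a using WithOne.recOneCoe with
    | one => simp
    | coe a => simp
  have e : insert Δ x =
      linearCombination ℂ (fun p => linearCombination ℂ (insertCell p) x) Δ.coeff := by
    simp [insert, linearCombination_apply, Finsupp.sum]
  rw [e, mul_comm, MonoidAlgebra.l1_apply]
  exact seminorm_linearCombination_le l1 _ fun p _ => h p

theorem insert_mem_within {T : Submonoid (WithOne S)}
    {Δ : MonoidAlgebra ℂ (WithOne S × WithOne S)} (hΔ : Δ ∈ sndSupported T) {x : Chain S n}
    (hx : x ∈ within T) : insert Δ x ∈ within T := by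
  have e : insert Δ x =
      linearCombination ℂ (fun p => linearCombination ℂ (insertCell p) x) Δ.coeff := by
    simp [insert, linearCombination_apply, Finsupp.sum]
  rw [e]
  refine linearCombination_mem _ _ fun p hp => linearCombination_mem _ _ fun c hc => ?_
  have hp' := mem_of_mem_support hΔ hp
  obtain ⟨b, a⟩ := p
  induction a using WithOne.recOneCoe with
  | one => simp
  | coe a =>
    refine single_mem_within (fun i => ?_) 1
    induction i using Fin.cases with
    | zero => exact hp'
    | succ i => exact mem_within.1 hx c hc i

/-- The coefficient of a chain multiplied by an element of the algebra. -/
noncomputable def scale : MonoidAlgebra ℂ (WithOne S) →ₗ[ℂ] Chain S n →ₗ[ℂ] Chain S n :=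
  (linearCombination ℂ act) ∘ₗ (MonoidAlgebra.coeffLinearEquiv ℂ).toLinearMap

theorem scale_single (p : WithOne S) (a : ℂ) (x : Chain S n) :
    scale (MonoidAlgebra.single p a) x = a • act p x := by
  simp [scale]

theorem contractNth_cons_zero (a : S) (t : Fin (n + 1) → S) :
    Fin.contractNth (0 : Fin (n + 1)).castSucc (· * ·) (Fin.cons a t : Fin (n + 2) → S) =
      Fin.cons (a * t 0) (Fin.tail t) := by
  ext i
  induction i using Fin.cases with
  | zero => simp [Fin.contractNth]
  | succ i => simp [Fin.contractNth, Fin.tail]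

theorem contractNth_cons_succ (j : Fin n) (a : S) (t : Fin (n + 1) → S) :
    Fin.contractNth j.succ.castSucc (· * ·) (Fin.cons a t : Fin (n + 2) → S) =
      Fin.cons a (Fin.contractNth j.castSucc (· * ·) t) := by
  ext i
  induction i using Fin.cases with
  | zero => simp [Fin.contractNth]
  | succ i => simp [Fin.contractNth]

/-- The faces of the enlarged cell beyond the first two cancel against the insertions into the faces
of `c` other than the zeroth. What survives is the face absorbing `a` into the coefficient and the
two ways in which the first entry meets `b ⊗ a`. -/
theorem bd_insert_single (b a : WithOne S) (c : Cell S (n + 1)) :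
    bd (insertCell (b, a) c) +
        insert (MonoidAlgebra.single (b, a) 1) (bd (single c 1)) =
      single (c.1 * (b * a), c.2) 1 + (insertCell ((c.2 0 : WithOne S) * b, a) (c.1, Fin.tail c.2) -
        insertCell (b, (c.2 0 : WithOne S) * a) (c.1, Fin.tail c.2)) := by
  obtain ⟨m, t⟩ := c
  induction a using WithOne.recOneCoe with
  -- Both terms on the left vanish. On the right, inserting the first entry back into the tail
  -- rebuilds the original cell, which cancels.
  | one =>
    have h (x : Chain S n) : insert (MonoidAlgebra.single (b, (1 : WithOne S)) 1) x = 0 := by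
      suffices h : insert (MonoidAlgebra.single (b, (1 : WithOne S)) 1) =
        (0 : Chain S n →ₗ[ℂ] Chain S (n + 1)) from DFunLike.congr_fun h x
      ext1 c
      ext1
      change insert (MonoidAlgebra.single (b, (1 : WithOne S)) 1) (single c 1) = 0
      simp
    rw [h]
    simp
  | coe a =>
    rw [insertCell_coe, bd_single_eq, bd_single_eq, Fin.sum_univ_succ, ← WithOne.coe_mul,
      insertCell_coe, insertCell_coe]
    simp only [map_add, map_sum, map_smul, insert_single, insertCell_coe, one_smul,
      contractNth_cons_zero, contractNth_cons_succ, Fin.tail_cons, Fin.cons_zero]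
    have e1 : (Fin.cons a t : Fin (n + 2) → S) (Fin.last (n + 1)) = t (Fin.last n) := rfl
    have e2 : Fin.init (Fin.cons a t : Fin (n + 2) → S) = Fin.cons a (Fin.init t) :=
      funext fun i => Fin.cases rfl (fun _ => rfl) i
    have e3 : m * (t (Fin.last n) : WithOne S) * b = m * b * t (Fin.last n) := mul_right_comm _ _ _
    have e4 : m * (t 0 : WithOne S) * b = m * (t 0 * b) := mul_assoc _ _ _
    simp only [e1, e2, e3, e4, Fin.val_zero, Fin.val_succ, pow_succ, pow_zero, mul_assoc,
      mul_comm a (t 0)]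
    simp
    abel

/-- If `Δ` multiplies to `1`, insertion is a contracting homotopy up to the commutator of `Δ` with
the first entry of the cell. -/
theorem bd_insert (Δ : MonoidAlgebra ℂ (WithOne S × WithOne S)) (c : Cell S (n + 1)) :
    bd (insert Δ (single c 1)) + insert Δ (bd (single c 1)) =
      scale (mulMap Δ) (single c 1) +
        insert ((tens (c.2 0 : WithOne S) 1 - tens 1 (c.2 0 : WithOne S)) * Δ)
          (single (c.1, Fin.tail c.2) 1) := by
  induction Δ using MonoidAlgebra.induction_linear with
  | zero => simp
  | add x y hx hy =>
    simp only [map_add, mul_add, LinearMap.add_apply] at hx hy ⊢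
    rw [add_add_add_comm, hx, hy]
    abel
  | single p r =>
    obtain ⟨b, a⟩ := p
    have e : MonoidAlgebra.single (b, a) r = r • MonoidAlgebra.single (b, a) 1 := by simp
    rw [e]
    simp only [map_smul, mul_smul_comm, LinearMap.smul_apply, ← smul_add]
    congr 1
    rw [insert_single, one_smul, bd_insert_single, mulMap_single, scale_single, one_smul,
      act_single, sub_mul, tens_mul, tens_mul, map_sub, LinearMap.sub_apply, insert_single,
      insert_single, one_smul, one_smul, one_mul, one_mul, mul_comm c.1]

theorem scale_one (x : Chain S n) : scale 1 x = x := by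
  rw [MonoidAlgebra.one_def, scale_single, one_smul]
  suffices h : act 1 = (LinearMap.id : Chain S n →ₗ[ℂ] Chain S n) from DFunLike.congr_fun h x
  ext1 c
  ext1
  change act 1 (single c 1) = single c 1
  simp

/-- Approximate filling of chains that are almost cycles. -/
theorem exists_filling {k : Type*} [Fintype k] (z w : k → WithOne S)
    (hz : ∀ i, z i * w i * z i = z i) (hw : ∀ i, w i * z i * w i = w i)
    {T : Submonoid (WithOne S)} (hT : T = Submonoid.closure (Set.range z ∪ Set.range w))
    {x : Chain S (n + 1)} (hx : x ∈ within T) {ε : ℝ} (hε : 0 < ε) :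
    ∃ y : Chain S (n + 2), y ∈ within T ∧ l1 y ≤ 5 ^ Fintype.card k * l1 x ∧
      l1 (x - bd y) ≤ 5 ^ Fintype.card k * l1 (bd x) + ε := by
  classical
  have hpos : 0 < ε / (l1 x + 1) := div_pos hε (by linarith [apply_nonneg l1 x])
  -- Only the first entries of the finitely many cells of `x` need to be almost central. The `+ 1`
  -- in the tolerance keeps it positive when `x = 0`.
  obtain ⟨Δ, hΔ, hΔ1, hΔ2, hΔ3⟩ := exists_approxDiag z w hz hw hT
    (x.support.image fun c => (c.2 0 : WithOne S))
    (by
      intro t ht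
      obtain ⟨c, hc, rfl⟩ := Finset.mem_image.1 ht
      exact mem_within.1 hx c hc 0) hpos
  refine ⟨insert Δ x, insert_mem_within hΔ hx,
    (l1_insert_le _ _).trans (mul_le_mul_of_nonneg_right hΔ1 (apply_nonneg _ _)), ?_⟩
  let E : Cell S (n + 1) → Chain S (n + 1) := fun c =>
    insert ((tens (c.2 0 : WithOne S) 1 - tens 1 (c.2 0 : WithOne S)) * Δ)
          (single (c.1, Fin.tail c.2) 1)
  have hE : bd (insert Δ x) + insert Δ (bd x) = x + linearCombination ℂ E x := by
    suffices h : bd ∘ₗ insert Δ + insert Δ ∘ₗ bd = LinearMap.id + linearCombination ℂ E from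
      DFunLike.congr_fun h x
    ext1 c
    ext1
    change bd (insert Δ (single c 1)) + insert Δ (bd (single c 1)) =
      single c 1 + linearCombination ℂ E (single c 1)
    rw [bd_insert, hΔ2, scale_one, linearCombination_single, one_smul]
  have hE' : l1 (linearCombination ℂ E x) ≤ ε := by
    refine (seminorm_linearCombination_le l1 x (C := ε / (l1 x + 1)) fun c hc => ?_).trans ?_
    · refine (l1_insert_le _ _).trans ?_
      rw [l1_single, norm_one, mul_one]
      exact hΔ3 _ (Finset.mem_image_of_mem _ hc)
    · rw [div_mul_eq_mul_div, div_le_iff₀ (by linarith [apply_nonneg l1 x])]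
      nlinarith
  have e : x - bd (insert Δ x) = insert Δ (bd x) - linearCombination ℂ E x := by
    rw [sub_eq_sub_iff_add_eq_add, ← hE]
    exact add_comm _ _
  rw [e]
  refine (map_sub_le_add l1 _ _).trans (add_le_add ?_ hE')
  exact (l1_insert_le _ _).trans (mul_le_mul_of_nonneg_right hΔ1 (apply_nonneg _ _))

end SymChain

/-! ### Approximate contracting homotopies with uniform bounds -/

namespace SymChain

open Finsupp

variable {S : Type u} [CommSemigroup S] {n : ℕ}

/-- The submonoid of the unitization generated by the entries of a tuple and their inverses. -/
def hull (i : S → S) (s : Fin n → S) : Submonoid (WithOne S) :=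
  Submonoid.closure
    ((Set.range fun j => (s j : WithOne S)) ∪ Set.range fun j => (i (s j) : WithOne S))

theorem coe_mem_hull (i : S → S) (s : Fin n → S) (j : Fin n) : (s j : WithOne S) ∈ hull i s :=
  Submonoid.subset_closure (Or.inl ⟨j, rfl⟩)

theorem coe_inv_mem_hull (i : S → S) (s : Fin n → S) (j : Fin n) :
    (i (s j) : WithOne S) ∈ hull i s :=
  Submonoid.subset_closure (Or.inr ⟨j, rfl⟩)

/-- Inner faces create products, whose inverses are products of inverses since `i` is
multiplicative. This lets fillings made for the faces of a tuple be used inside the submonoid of the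
tuple. -/
theorem hull_face_le {i : S → S} (hi : ∀ s t, i (s * t) = i s * i t) (k : ℕ)
    (c : Cell S (n + 1)) : hull i (face k c).2 ≤ hull i c.2 := by
  have h (j) : (i ((face k c).2 j) : WithOne S) ∈ hull i c.2 := by
    unfold face
    split_ifs
    · exact coe_inv_mem_hull i c.2 _
    · dsimp only [Fin.contractNth]
      split_ifs
      · exact coe_inv_mem_hull i c.2 _
      · rw [hi, WithOne.coe_mul]
        exact mul_mem (coe_inv_mem_hull i c.2 _) (coe_inv_mem_hull i c.2 _)
      · exact coe_inv_mem_hull i c.2 _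
    · exact coe_inv_mem_hull i c.2 _
  refine Submonoid.closure_le.2 ?_
  rintro _ (⟨j, rfl⟩ | ⟨j, rfl⟩)
  · exact face_mem (coe_mem_hull i c.2) k j
  · exact h j

/-- In every positive degree there is a bounded approximate contracting homotopy. -/
theorem exists_approx_homotopy {i : S → S} (h1 : ∀ s, s * i s * s = s)
    (h2 : ∀ s, i s * s * i s = i s) (hi : ∀ s t, i (s * t) = i s * i t) (n : ℕ) :
    ∀ ε : ℝ, 0 < ε → ∃ (C : ℝ) (σ : (Fin n → S) → Chain S (n + 1)),
      (∀ s, l1 (σ s) ≤ C ∧ σ s ∈ within (hull i s)) ∧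
      ∀ s : Fin (n + 1) → S, ∃ w : Chain S (n + 2), l1 w ≤ C ∧ w ∈ within (hull i s) ∧
        l1 (single (1, s) 1 - extend σ (bd (single (1, s) 1)) - bd w) ≤ ε := by
  have fill {k m : ℕ} (s : Fin k → S) {x : Chain S (m + 1)} (hx : x ∈ within (hull i s)) {ε : ℝ}
      (hε : 0 < ε) : ∃ y : Chain S (m + 2), y ∈ within (hull i s) ∧ l1 y ≤ 5 ^ k * l1 x ∧
        l1 (x - bd y) ≤ 5 ^ k * l1 (bd x) + ε := by
    have := exists_filling (fun j => (s j : WithOne S)) (fun j => (i (s j) : WithOne S))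
      (fun j => by rw [← WithOne.coe_mul, ← WithOne.coe_mul, h1])
      (fun j => by rw [← WithOne.coe_mul, ← WithOne.coe_mul, h2]) rfl hx hε
    rw [Fintype.card_fin] at this
    exact this
  have hgen {m : ℕ} (s : Fin m → S) : single (1, s) 1 ∈ within (hull i s) :=
    single_mem_within (c := ((1 : WithOne S), s)) (coe_mem_hull i s) 1
  induction n with
  | zero =>
    intro ε hε
    -- No lower homotopy is needed, because a 1-cell is a cycle: its two faces coincide. Its filling
    -- uses one generator, hence the constant `5`.
    refine ⟨5, 0, fun s => ⟨by simp, zero_mem _⟩, fun s => ?_⟩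
    obtain ⟨w, hw, hw1, hw2⟩ := fill s (hgen s) hε
    have hbd : bd (single ((1 : WithOne S), s) (1 : ℂ)) = 0 := by
      rw [bd_single_eq]
      have : Fin.tail s = Fin.init s := Subsingleton.elim _ _
      simp [this]
    refine ⟨w, by simpa using hw1, hw, ?_⟩
    rw [hbd, map_zero] at hw2 ⊢
    simpa using hw2
  | succ n ih =>
    intro ε hε
    -- The factor `n + 3` counts the faces of an `(n + 2)`-cell, and `5 ^ (n + 2)` is the loss in
    -- filling over `n + 2` generators. Tolerance `ε / (2 * K)` one degree below thus costs `ε / 2`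
    -- here.
    set K : ℝ := 5 ^ (n + 2) * (n + 3) with hK
    have hK0 : 0 < K := by positivity
    obtain ⟨C, σ, hσ, H⟩ := ih (ε / (2 * K)) (by positivity)
    choose w hw1 hw2 hw3 using H
    -- The fillings `w` of the previous degree become the homotopy of this degree.
    refine ⟨max C (5 ^ (n + 2) * (1 + C * (n + 3))), w, fun s =>
      ⟨(hw1 s).trans (le_max_left _ _), hw2 s⟩, fun s => ?_⟩
    have hC : 0 ≤ C := (apply_nonneg _ _).trans (hw1 (Fin.tail s))
    set u : Chain S (n + 2) := single (1, s) 1 with hu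
    have hbu : l1 (bd u) ≤ n + 3 := by
      refine (l1_bd_le u).trans_eq ?_
      rw [hu, l1_single, norm_one]
      push_cast
      ring
    -- Since `bd (bd u) = 0`, the boundary of `z` is the previous error operator applied to `bd u`;
    -- so `z` is almost a cycle and can be filled approximately.
    set z : Chain S (n + 2) := u - extend w (bd u) with hz
    have hz1 : l1 z ≤ 1 + C * (n + 3) := by
      refine (map_sub_le_add l1 _ _).trans (add_le_add (by simp [hu]) ?_)
      exact (l1_extend_le hw1 _).trans (mul_le_mul_of_nonneg_left hbu hC)
    have hz2 : z ∈ within (hull i s) := by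
      refine sub_mem (hgen s) ?_
      rw [hu, bd_single, map_sum]
      refine sum_mem fun k _ => ?_
      rw [map_smul, extend_single]
      exact Submodule.smul_mem _ _
        (act_mem_within (within_mono (hull_face_le hi k (1, s)) (hw2 _)) _)
    -- The error operator commutes with multiplication of coefficients, so its bound on cells with
    -- coefficient `1` passes to all chains.
    have hE (x : Chain S (n + 1)) : x - extend σ (bd x) - bd (extend w x) =
        extend (fun t => single (1, t) 1 - extend σ (bd (single (1, t) 1)) - bd (w t)) x := by
      suffices h : LinearMap.id - extend σ ∘ₗ bd - bd ∘ₗ extend w =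
        extend (fun t => single (1, t) 1 - extend σ (bd (single (1, t) 1)) - bd (w t)) from
          DFunLike.congr_fun h x
      ext1 c
      ext1
      change single c 1 - extend σ (bd (single c 1)) - bd (extend w (single c 1)) =
        extend (fun t => single (1, t) 1 - extend σ (bd (single (1, t) 1)) - bd (w t))
          (single c 1)
      rw [extend_single, extend_single, map_sub, map_sub, ← extend_act, ← bd_act, ← bd_act,
        act_single, mul_one]
    have hbz : l1 (bd z) ≤ ε / (2 * K) * (n + 3) := by
      have e : bd z = bd u - extend σ (bd (bd u)) - bd (extend w (bd u)) := by
        rw [bd_bd, map_zero, sub_zero, hz, map_sub]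
      rw [e, hE]
      exact (l1_extend_le hw3 _).trans (mul_le_mul_of_nonneg_left hbu (by positivity))
    obtain ⟨y, hy1, hy2, hy3⟩ := fill s hz2 (half_pos hε)
    refine ⟨y, hy2.trans (le_trans ?_ (le_max_right _ _)), hy1, hy3.trans ?_⟩
    · exact mul_le_mul_of_nonneg_left hz1 (by positivity)
    · have := mul_le_mul_of_nonneg_left hbz (show (0 : ℝ) ≤ 5 ^ (n + 2) by positivity)
      have e : (5 : ℝ) ^ (n + 2) * (ε / (2 * K) * (n + 3)) = ε / 2 := by
        rw [hK]
        field_simp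
      linarith

end SymChain

/-! ## Cochains on `ℓ¹` spaces -/

namespace EllOne

variable {S : Type u} {E : Type v} [NormedAddCommGroup E] [NormedSpace ℂ E]

open Classical in
/-- The point mass at `s`. -/
noncomputable def delta (s : S) : EllOne S := lp.single 1 s 1

theorem norm_delta (s : S) : ‖delta s‖ = 1 := by
  simp [delta, lp.norm_single]

theorem delta_mul [Semigroup S] (s t : S) : delta s * delta t = delta (s * t) := by
  classical
  have := conv_single s t (1 : ℂ) 1
  rw [mul_one] at this
  exact this

open Classical in
theorem hasSum_smul_delta (f : EllOne S) : HasSum (fun s => f s • delta s) f := by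
  have := lp.hasSum_single (E := fun _ : S => ℂ) (p := 1) (by simp) f
  convert this using 2 with s
  rw [delta, ← lp.single_smul, smul_eq_mul, mul_one]

theorem norm_clm_le (T : EllOne S →L[ℂ] E) {C : ℝ} (hC : 0 ≤ C) (h : ∀ s, ‖T (delta s)‖ ≤ C) :
    ‖T‖ ≤ C := by
  refine T.opNorm_le_bound hC fun f => ?_
  have h1 : HasSum (fun s => f s • T (delta s)) (T f) := by
    simpa using T.hasSum (hasSum_smul_delta f)
  have h2 : HasSum (fun s => ‖f s‖ * C) (‖f‖ * C) := by
    rw [norm_eq]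
    exact f.summable_norm.hasSum.mul_right C
  rw [mul_comm]
  refine (h1.norm_le_of_bounded h2 fun s => ?_)
  rw [norm_smul]
  exact mul_le_mul_of_nonneg_left (h s) (norm_nonneg _)

theorem exists_clm [CompleteSpace E] (b : S → E) {C : ℝ} (h : ∀ s, ‖b s‖ ≤ C) :
    ∃ T : EllOne S →L[ℂ] E, ∀ s, T (delta s) = b s := by
  classical
  have hs (f : EllOne S) : Summable fun s => f s • b s := by
    refine .of_norm_bounded (f.summable_norm.mul_right C) fun s => ?_
    rw [norm_smul]
    exact mul_le_mul_of_nonneg_left (h s) (norm_nonneg _)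
  let T : EllOne S →ₗ[ℂ] E :=
    { toFun := fun f => ∑' s, f s • b s
      map_add' := fun f g => by
        simp only [lp.coeFn_add, Pi.add_apply, add_smul]
        exact (hs f).tsum_add (hs g)
      map_smul' := fun c f => by
        simp only [lp.coeFn_smul, Pi.smul_apply, smul_assoc, RingHom.id_apply]
        exact (hs f).tsum_const_smul c }
  refine ⟨T.mkContinuous C fun f => ?_, fun s => ?_⟩
  · have h2 : HasSum (fun s => ‖f s‖ * C) (‖f‖ * C) := by
      rw [norm_eq]
      exact f.summable_norm.hasSum.mul_right C
    rw [mul_comm]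
    refine (hs f).hasSum.norm_le_of_bounded h2 fun s => ?_
    rw [norm_smul]
    exact mul_le_mul_of_nonneg_left (h s) (norm_nonneg _)
  · change ∑' t, (delta s : EllOne S) t • b t = b s
    rw [tsum_eq_single s]
    · simp [delta]
    · intro t ht
      simp [delta, ht]

/-- The norm of a multilinear map on `ℓ¹(S)` is determined by its values on point masses. -/
theorem norm_multilinear_le {n : ℕ} (f : ContinuousMultilinearMap ℂ (fun _ : Fin n => EllOne S) E)
    {C : ℝ} (hC : 0 ≤ C) (h : ∀ s : Fin n → S, ‖f fun i => delta (s i)‖ ≤ C) : ‖f‖ ≤ C := by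
  induction n with
  | zero =>
    refine f.opNorm_le_bound hC fun m => ?_
    have := h Fin.elim0
    rw [Subsingleton.elim m fun i => delta (Fin.elim0 i)]
    simpa using this
  | succ n ih =>
    rw [← f.curryLeft_norm]
    refine norm_clm_le _ hC fun s => ih _ fun t => ?_
    have := h (Fin.cons s t)
    rw [f.curryLeft_apply]
    convert this using 3
    ext1 i
    refine Fin.cases ?_ (fun i => ?_) i <;> simp

/-- By currying, this reduces to the universal property of `ℓ¹`: bounded functions on `S` extend to
bounded operators. Cochains can thus be prescribed freely on tuples of point masses. -/
theorem exists_multilinear [CompleteSpace E] {n : ℕ} (b : (Fin n → S) → E) {C : ℝ} (hC : 0 ≤ C)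
    (h : ∀ s, ‖b s‖ ≤ C) :
    ∃ f : ContinuousMultilinearMap ℂ (fun _ : Fin n => EllOne S) E,
      ∀ s, f (fun i => delta (s i)) = b s := by
  induction n with
  | zero =>
    refine ⟨ContinuousMultilinearMap.constOfIsEmpty ℂ _ (b Fin.elim0), fun s => ?_⟩
    rw [Subsingleton.elim s Fin.elim0]
    rfl
  | succ n ih =>
    choose F hF using fun s : S => ih (fun t => b (Fin.cons s t)) fun t => h _
    obtain ⟨T, hT⟩ := exists_clm F (C := C) fun s =>
      norm_multilinear_le _ hC fun t => by rw [hF]; exact h _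
    refine ⟨T.uncurryLeft, fun s => ?_⟩
    rw [ContinuousLinearMap.uncurryLeft_apply, hT]
    exact (hF (s 0) (Fin.tail s)).trans (by rw [Fin.cons_self_tail])

end EllOne

/-- A bounded operator that solves `f v = z` up to an error of at most `‖z‖ / 2` on a subspace
containing its range, with control of `‖v‖`, has that subspace as its range. -/
theorem ContinuousLinearMap.exists_preimage_of_approx {V W : Type*} [NormedAddCommGroup V]
    [NormedSpace ℂ V] [CompleteSpace V] [NormedAddCommGroup W] [NormedSpace ℂ W]
    (f : V →L[ℂ] W) (Z : Submodule ℂ W) (hf : ∀ v, f v ∈ Z) {K : ℝ}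
    (h : ∀ z ∈ Z, ∃ v, ‖v‖ ≤ K * ‖z‖ ∧ ‖z - f v‖ ≤ 1 / 2 * ‖z‖) {z : W} (hz : z ∈ Z) :
    ∃ v, f v = z := by
  choose g hg1 hg2 using fun z : Z => h z z.2
  -- The residual stays in `Z` because `f` takes values there, and its norm at least halves. The
  -- corrections are then summable and their sum is the preimage.
  let step : Z → Z := fun z => z - ⟨f (g z), hf _⟩
  let y : ℕ → Z := fun k => step^[k] ⟨z, hz⟩
  have hy (k : ℕ) : (y (k + 1) : W) = y k - f (g (y k)) := by
    simp only [y, Function.iterate_succ_apply']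
    rfl
  have hyn (k : ℕ) : ‖(y k : W)‖ ≤ (1 / 2) ^ k * ‖z‖ := by
    induction k with
    | zero => simp [y]
    | succ k ih =>
      rw [hy, pow_succ', mul_assoc]
      exact (hg2 _).trans (mul_le_mul_of_nonneg_left ih (by norm_num))
  have hsum : Summable fun k => g (y k) := by
    have hgeo : Summable fun k : ℕ => |K| * ((1 / 2 : ℝ) ^ k * ‖z‖) :=
      ((summable_geometric_of_lt_one (by norm_num) (by norm_num)).mul_right _).mul_left _
    refine .of_norm_bounded hgeo fun k => (hg1 _).trans ?_
    exact mul_le_mul (le_abs_self K) (hyn k) (norm_nonneg _) (abs_nonneg K)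
  refine ⟨∑' k, g (y k), tendsto_nhds_unique (f.hasSum hsum.hasSum).tendsto_sum_nat ?_⟩
  have hpart (N : ℕ) : ∑ k ∈ Finset.range N, f (g (y k)) = z - y N := by
    induction N with
    | zero => simp [y]
    | succ N ih => rw [Finset.sum_range_succ, ih, hy]; abel
  have hlim : Filter.Tendsto (fun N => (y N : W)) Filter.atTop (nhds 0) := by
    refine squeeze_zero_norm hyn ?_
    simpa using (tendsto_pow_atTop_nhds_zero_of_lt_one (r := (1 / 2 : ℝ)) (by norm_num)
      (by norm_num)).mul_const ‖z‖
  simpa only [Function.comp_def, hpart, sub_zero] using hlim.const_sub z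

/-! ### Duality between cochains and chains, and the vanishing theorem -/

namespace BanachBimodule

open Finsupp SymChain EllOne

variable {S : Type u} [CommSemigroup S] {X : Type v} [NormedAddCommGroup X] [NormedSpace ℂ X]
  (M : BanachBimodule (EllOne S) X) {n : ℕ}

/-- The action of the unitization of `S` on a bimodule over `ℓ¹(S)`. -/
noncomputable def pointAct (p : WithOne S) : X →L[ℂ] X :=
  WithOne.recOneCoe (motive := fun _ => X →L[ℂ] X) (.id ℂ X) (fun s => M.left (delta s)) p

@[simp]
theorem pointAct_one : M.pointAct 1 = .id ℂ X := rfl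

@[simp]
theorem pointAct_coe (s : S) : M.pointAct s = M.left (delta s) := rfl

theorem pointAct_mul (p q : WithOne S) (x : X) :
    M.pointAct (p * q) x = M.pointAct p (M.pointAct q x) := by
  induction p with
  | one => simp
  | coe s =>
    induction q with
    | one => simp
    | coe t => rw [← WithOne.coe_mul, pointAct_coe, ← delta_mul, left_mul]; rfl

theorem norm_pointAct_le (p : WithOne S) : ‖M.pointAct p‖ ≤ 1 + ‖M.left‖ := by
  induction p with
  | one =>
    rw [pointAct_one]
    linarith [ContinuousLinearMap.norm_id_le (𝕜 := ℂ) (E := X), norm_nonneg M.left]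
  | coe s =>
    rw [pointAct_coe]
    have := M.left.le_opNorm (delta s)
    rw [norm_delta, mul_one] at this
    linarith

/-- The evaluation of a cochain on algebraic chains. -/
noncomputable def evalChain (ψ : Cochain (EllOne S) X n) : Chain S n →ₗ[ℂ] X :=
  linearCombination ℂ fun c => M.pointAct c.1 (ψ fun i => delta (c.2 i))

@[simp]
theorem evalChain_single (ψ : Cochain (EllOne S) X n) (c : Cell S n) :
    M.evalChain ψ (single c 1) = M.pointAct c.1 (ψ fun i => delta (c.2 i)) := by
  simp [evalChain]

theorem evalChain_act (ψ : Cochain (EllOne S) X n) (p : WithOne S) (x : Chain S n) :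
    M.evalChain ψ (act p x) = M.pointAct p (M.evalChain ψ x) := by
  suffices h : M.evalChain ψ ∘ₗ act p = (M.pointAct p).toLinearMap ∘ₗ M.evalChain ψ from
    DFunLike.congr_fun h x
  ext1 c
  ext1
  change M.evalChain ψ (act p (single c 1)) = M.pointAct p (M.evalChain ψ (single c 1))
  rw [act_single, evalChain_single, evalChain_single, pointAct_mul]

theorem norm_evalChain_le (ψ : Cochain (EllOne S) X n) (x : Chain S n) :
    ‖M.evalChain ψ x‖ ≤ (1 + ‖M.left‖) * ‖ψ‖ * l1 x := by
  refine seminorm_linearCombination_le (normSeminorm ℂ X) x fun c _ => ?_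
  refine ((M.pointAct c.1).le_opNorm _).trans ?_
  have h : ‖ψ fun i => delta (c.2 i)‖ ≤ ‖ψ‖ := by
    simpa [norm_delta] using ψ.le_opNorm fun i => delta (c.2 i)
  exact mul_le_mul (M.norm_pointAct_le _) h (norm_nonneg _) (by positivity)

theorem contractNth_delta (j : Fin n) (s : Fin (n + 1) → S) :
    Fin.contractNth j.castSucc (· * ·) (fun i => delta (s i)) =
      fun i => delta (Fin.contractNth j.castSucc (· * ·) s i) := by
  ext1 i
  simp only [Fin.contractNth]
  split_ifs
  · rfl
  · exact delta_mul _ _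
  · rfl

variable {M} in
-- Symmetry turns the right action in the last coface into a left action, matching the last face,
-- which multiplies the one-sided coefficient.
theorem evalChain_bd (hM : M.IsSymmetric) (ψ : Cochain (EllOne S) X n) (x : Chain S (n + 1)) :
    M.evalChain ψ (bd x) = M.evalChain (M.coboundary n ψ) x := by
  suffices h : M.evalChain ψ ∘ₗ bd = M.evalChain (M.coboundary n ψ) from DFunLike.congr_fun h x
  ext1 c
  ext1
  change M.evalChain ψ (bd (single c 1)) = M.evalChain (M.coboundary n ψ) (single c 1)
  rw [bd_single_eq, evalChain_single, coboundary_apply, ← hM]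
  simp only [map_add, map_sum, map_smul, evalChain_single, pointAct_mul, pointAct_coe,
    contractNth_delta]
  rfl

variable {M}

theorem coboundary_delta (hM : M.IsSymmetric) (ψ : Cochain (EllOne S) X n)
    (s : Fin (n + 1) → S) : M.coboundary n ψ (fun i => delta (s i)) =
      M.evalChain ψ (bd (single (1, s) 1)) := by
  rw [evalChain_bd hM, evalChain_single]
  rfl

/-- The Hochschild coboundary as a bounded operator. -/
theorem exists_coboundary_clm (hM : M.IsSymmetric) (n : ℕ) :
    ∃ D : Cochain (EllOne S) X n →L[ℂ] Cochain (EllOne S) X (n + 1),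
      ∀ ψ, D ψ = M.coboundary n ψ := by
  refine ⟨(M.coboundary n).mkContinuous ((1 + ‖M.left‖) * (n + 2)) fun ψ => ?_, fun ψ => rfl⟩
  refine norm_multilinear_le _ (by positivity) fun s => ?_
  rw [coboundary_delta hM]
  refine (M.norm_evalChain_le _ _).trans ?_
  have := l1_bd_le (single ((1 : WithOne S), s) (1 : ℂ))
  rw [l1_single, norm_one, mul_one] at this
  calc _ ≤ (1 + ‖M.left‖) * ‖ψ‖ * (n + 2) := mul_le_mul_of_nonneg_left this (by positivity)
    _ = _ := by ring

/-- Cocycles over a commutative Clifford semigroup with symmetric coefficients are approximate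
coboundaries, with uniform control. -/
theorem exists_approx_primitive [CompleteSpace X] (hS : IsCliffordSemigroup S)
    (hM : M.IsSymmetric) (n : ℕ) :
    ∃ K : ℝ, ∀ ψ ∈ M.cocycles (n + 1), ∃ φ : Cochain (EllOne S) X n,
      ‖φ‖ ≤ K * ‖ψ‖ ∧ ‖ψ - M.coboundary n φ‖ ≤ 1 / 2 * ‖ψ‖ := by
  obtain ⟨i, h1, h2, hi⟩ := hS.exists_inverse
  set B : ℝ := 1 + ‖M.left‖ with hB
  have hB0 : 0 < B := by positivity
  -- Evaluating `ψ` on a chain costs a factor `B * ‖ψ‖`, so this tolerance leaves an error of `‖ψ‖ /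
  -- 2`.
  obtain ⟨C, σ, hσ, H⟩ := exists_approx_homotopy h1 h2 hi n (1 / (2 * B)) (by positivity)
  -- The constant `C` is not known to be nonnegative when there are no tuples, hence the maximum.
  refine ⟨B * max C 0, fun ψ hψ => ?_⟩
  have hb (s : Fin n → S) : ‖M.evalChain ψ (σ s)‖ ≤ B * max C 0 * ‖ψ‖ := by
    refine (M.norm_evalChain_le _ _).trans ?_
    rw [mul_right_comm]
    exact mul_le_mul_of_nonneg_right
      (mul_le_mul_of_nonneg_left ((hσ s).1.trans (le_max_left _ _)) hB0.le) (norm_nonneg _)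
  have hpos : 0 ≤ B * max C 0 * ‖ψ‖ := by positivity
  obtain ⟨φ, hφ⟩ := exists_multilinear (fun s => M.evalChain ψ (σ s)) hpos hb
  refine ⟨φ, norm_multilinear_le _ hpos fun s => by rw [hφ]; exact hb s, ?_⟩
  have hext (x : Chain S n) : M.evalChain φ x = M.evalChain ψ (extend σ x) := by
    suffices h : M.evalChain φ = M.evalChain ψ ∘ₗ extend σ from DFunLike.congr_fun h x
    ext1 c
    ext1
    change M.evalChain φ (single c 1) = M.evalChain ψ (extend σ (single c 1))
    rw [evalChain_single, extend_single, evalChain_act, hφ]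
  have hcoc : M.coboundary (n + 1) ψ = 0 := hψ
  refine norm_multilinear_le _ (by positivity) fun s => ?_
  obtain ⟨w, -, -, hw⟩ := H s
  -- The term `bd w` may be subtracted freely, since the cocycle `ψ` vanishes on boundaries. Only
  -- the existence of a `w` with small error matters here, not its size.
  have e : (ψ - M.coboundary n φ) (fun i => delta (s i)) =
      M.evalChain ψ (single (1, s) 1 - extend σ (bd (single (1, s) 1)) - bd w) := by
    rw [map_sub, map_sub, ← hext, ← coboundary_delta hM, evalChain_bd hM, hcoc, evalChain_single]
    simp [evalChain, linearCombination_apply]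
  rw [e]
  refine (M.norm_evalChain_le _ _).trans ?_
  refine (mul_le_mul_of_nonneg_left hw (by positivity)).trans_eq ?_
  rw [← hB]
  field_simp

end BanachBimodule

theorem theorem6p3 {S : Type u} [CommSemigroup S] (hS : IsCliffordSemigroup S)
    {X : Type v} [NormedAddCommGroup X] [NormedSpace ℂ X] [CompleteSpace X]
    (M : BanachBimodule (EllOne S) X) (hM : M.IsSymmetric) :
    ∀ n : ℕ, 1 ≤ n → Subsingleton (M.HochschildCohomology n) := by
  intro n hn
  obtain ⟨n, rfl⟩ : ∃ k, n = k + 1 := ⟨n - 1, by omega⟩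
  obtain ⟨D, hD⟩ := BanachBimodule.exists_coboundary_clm hM n
  obtain ⟨K, hK⟩ := BanachBimodule.exists_approx_primitive hS hM n
  rw [Submodule.Quotient.subsingleton_iff, Submodule.submoduleOf,
    Submodule.comap_subtype_eq_top]
  intro ψ hψ
  obtain ⟨φ, hφ⟩ := D.exists_preimage_of_approx (M.cocycles (n + 1))
    (fun φ => by rw [hD]; exact M.coboundary_coboundary φ) (K := K)
    (by simpa only [hD] using hK) hψ
  exact ⟨φ, (hD φ).symm.trans hφ⟩
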